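/- Let $G$ be a finite group and let $\alpha\colon G^3\to U(1)$ be a normalized $3$-cocycle, i.e. $\alpha(g_1,g_2,g_3)\,\alpha(g_0g_1,g_2,g_3)^{-1}\alpha(g_0,g_1g_2,g_3)\,\alpha(g_0,g_1,g_2g_3)^{-1}\alpha(g_0,g_1,g_2)=1$ and $\alpha(1,g,h)=\alpha(g,1,h)=\alpha(g,h,1)=1$. Put $$\beta_a(b,c)=\frac{\alpha(a,b,c)\,\alpha(b,c,c^{-1}b^{-1}abc)}{\alpha(b,b^{-1}ab,c)},\qquad \eta^g(h,x)=\frac{\beta_g(x^{-1},xhx^{-1})}{\beta_g(h,x^{-1})},$$ and let $Z_g$ be the centralizer of $g$. A $\beta_g$-representation of $Z_g$ is a map $\widetilde\rho$ from $Z_g$ to some $GL_d(\mathbb C)$ with $\widetilde\rho(x)\widetilde\rho(y)=\beta_g(x,y)\widetilde\rho(xy)$; an element $h\in Z_g$ is $\beta_g$-regular if $\beta_g(h,k)=\beta_g(k,h)$ for all $k\in Z_g$ commuting with $h$. Triangulate the torus by the two triangles $124$ and $134$, with the edge $[12]$ identified with $[34]$ and $[13]$ with $[24]$. Its Hilbert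 space has an orthonormal basis of all assignments of elements of $G$ to the three edges $[13],[12],[14]$. The face operators $B_{124}$ and $B_{134}$ project onto the assignments with $[12][24]=[14]$ and $[13][34]=[14]$ respectively; the assignments that satisfy both conditions are those with $[13]=g$, $[12]=h$, $[14]=gh=hg$, and their basis vectors are written $|g,h\rangle$ $(gh=hg)$. On these the vertex operators act by $$A^x|g,h\rangle=\frac{\alpha(g,hx^{-1},x)\,\alpha(hx^{-1},x,gx^{-1})\,\alpha(x,gx^{-1},xhx^{-1})}{\alpha(h,gx^{-1},x)\,\alpha(gx^{-1},x,hx^{-1})\,\alpha(x,hx^{-1},xgx^{-1})}\,|xgx^{-1},xhx^{-1}\rangle .$$ The ground space is $\mathcal H^0=\{\Phi: P^0\Phi=\Phi\}$ with $P^0=B_{124}B_{134}\,\frac1{|G|}\sum_{x\in G}A^x$. For every conjugacy class $C^A$ of $G$ choose a representative $g^A$ and a list $(\widetilde\rho^{\,g^A}_\mu)_\mu$ containing exactly one member of each equivalence class of irreducible $\beta_{g^A}$-representations of $Z_{g^A}$. Then: 1. The list extends to a family of $\beta_g$-representations $\widetilde\rho^{\,g}_\mu$ of $Z_g$, for all $g\in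 C^A$ and with the same labels $\mu$, such that for each $g\in C^A$ the $\widetilde\rho^{\,g}_\mu$ again contain exactly one member of each equivalence class of irreducible $\beta_g$-representations, and such that the characters $\widetilde\chi^g_\mu=\operatorname{tr}\widetilde\rho^{\,g}_\mu$ satisfy $$\widetilde\chi^{xgx^{-1}}_\mu(xhx^{-1})=\eta^g(h,x)\,\widetilde\chi^g_\mu(h)\qquad(g\in C^A,\ h\in Z_g,\ x\in G).\tag{$*$}$$ 2. For each $A$ the number of labels $\mu$ is finite and equals the number $r(Z_{g^A},\beta_{g^A})$ of conjugacy classes of $Z_{g^A}$ that consist of $\beta_{g^A}$-regular elements. 3. For every family of $\beta_g$-representations $\widetilde\rho^{\,g}_\mu$ $(g\in C^A)$ that extends the chosen list and satisfies $(*)$, the vectors $$|A,\mu\rangle=\frac1{\sqrt{|G|}}\sum_{g\in C^A,\ h\in Z_g}\widetilde\chi^g_\mu(h)\,|g,h\rangle ,$$ with $A$ running over the conjugacy classes and $\mu$ over the labels belonging to $A$, form an orthonormal basis of $\mathcal H^0$. -/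

import Mathlib

namespace TQD

/-- A normalized `3`-cocycle `α : G³ → U(1)`. -/
structure NormalizedThreeCocycle (G : Type*) [Group G] where
  toFun : G → G → G → Circle
  cocycle : ∀ g₀ g₁ g₂ g₃ : G,
    toFun g₁ g₂ g₃ * (toFun (g₀ * g₁) g₂ g₃)⁻¹ * toFun g₀ (g₁ * g₂) g₃ *
      (toFun g₀ g₁ (g₂ * g₃))⁻¹ * toFun g₀ g₁ g₂ = 1
  one_left : ∀ g h : G, toFun 1 g h = 1
  one_mid : ∀ g h : G, toFun g 1 h = 1
  one_right : ∀ g h : G, toFun g h 1 = 1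

instance {G : Type*} [Group G] :
    CoeFun (NormalizedThreeCocycle G) (fun _ => G → G → G → Circle) :=
  ⟨NormalizedThreeCocycle.toFun⟩

section Algebra

variable {G : Type*} [Group G]

/-- `β_a(b,c) = α(a,b,c) α(b,c,c⁻¹b⁻¹abc) / α(b,b⁻¹ab,c)`. -/
noncomputable def beta (α : NormalizedThreeCocycle G) (a b c : G) : Circle :=
  α a b c * α b c (c⁻¹ * b⁻¹ * a * b * c) / α b (b⁻¹ * a * b) c

/-- `η^g(h,x) = β_g(x⁻¹,xhx⁻¹) / β_g(h,x⁻¹)`. -/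
noncomputable def eta (α : NormalizedThreeCocycle G) (g h x : G) : Circle :=
  beta α g x⁻¹ (x * h * x⁻¹) / beta α g h x⁻¹

/-- The centralizer `Z_g`. -/
abbrev Cent (g : G) : Subgroup G := Subgroup.centralizer ({g} : Set G)

theorem conj_mem_carrier {A : ConjClasses G} {g : G} (hg : g ∈ A.carrier) (x : G) :
    x * g * x⁻¹ ∈ A.carrier := by
  rw [ConjClasses.mem_carrier_iff_mk_eq] at hg ⊢
  rw [← hg]
  exact (ConjClasses.mk_eq_mk_iff_isConj.2 (isConj_iff.2 ⟨x, rfl⟩)).symm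

/-- For `h ∈ Z_g`, the element `xhx⁻¹` of `Z_{xgx⁻¹}`. -/
def conjCent {g : G} (x : G) (h : Cent g) : Cent (x * g * x⁻¹) :=
  ⟨x * h * x⁻¹, by
    have hh := Subgroup.mem_centralizer_singleton_iff.1 h.2
    rw [Subgroup.mem_centralizer_singleton_iff]
    calc x * (h : G) * x⁻¹ * (x * g * x⁻¹) = x * ((h : G) * g) * x⁻¹ := by group
      _ = x * (g * (h : G)) * x⁻¹ := by rw [hh]
      _ = x * g * x⁻¹ * (x * (h : G) * x⁻¹) := by group⟩

/-- `h ∈ Z_g` is `β_g`-regular: `β_g(h,k) = β_g(k,h)` for every `k ∈ Z_g` commuting with `h`. -/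
def IsRegular (α : NormalizedThreeCocycle G) (g : G) (h : Cent g) : Prop :=
  ∀ k : Cent g, k * h = h * k → beta α g h k = beta α g k h

/-- The number `r(Z_g, β_g)` of `β_g`-regular conjugacy classes of the group `Z_g`. -/
noncomputable def numRegularClasses (α : NormalizedThreeCocycle G) (g : G) : ℕ :=
  Nat.card {c : ConjClasses (Cent g) // ∀ h ∈ c.carrier, IsRegular α g h}

end Algebra

section Representations

open Matrix

/-- A finite-dimensional complex projective representation `ρ : Z → GL_d(ℂ)` of `Z` with
factor system `b`, that is `ρ(x) ρ(y) = b(x,y) ρ(xy)`. -/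
structure ProjRep (Z : Type*) [Group Z] (b : Z → Z → Circle) where
  dim : ℕ
  toFun : Z → GL (Fin dim) ℂ
  map_mul : ∀ x y : Z,
    (toFun x : Matrix (Fin dim) (Fin dim) ℂ) * (toFun y : Matrix (Fin dim) (Fin dim) ℂ) =
      (b x y : ℂ) • (toFun (x * y) : Matrix (Fin dim) (Fin dim) ℂ)

namespace ProjRep

variable {Z : Type*} [Group Z] {b : Z → Z → Circle}

/-- The matrix `ρ(z)`. -/
def mat (ρ : ProjRep Z b) (z : Z) : Matrix (Fin ρ.dim) (Fin ρ.dim) ℂ := (ρ.toFun z).1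

/-- The projective character `tr ρ(z)`. -/
def character (ρ : ProjRep Z b) (z : Z) : ℂ := (ρ.mat z).trace

/-- Nonzero, and without proper nonzero invariant subspaces. -/
def IsIrreducible (ρ : ProjRep Z b) : Prop :=
  0 < ρ.dim ∧ ∀ W : Submodule ℂ (Fin ρ.dim → ℂ),
    (∀ z : Z, ∀ v ∈ W, ρ.mat z *ᵥ v ∈ W) → W = ⊥ ∨ W = ⊤

/-- Equivalence: there is an invertible intertwiner. -/
def IsEquivalent (ρ σ : ProjRep Z b) : Prop :=
  ∃ f : (Fin ρ.dim → ℂ) ≃ₗ[ℂ] (Fin σ.dim → ℂ),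
    ∀ (z : Z) (v : Fin ρ.dim → ℂ), f (ρ.mat z *ᵥ v) = σ.mat z *ᵥ f v

end ProjRep

/-- `(ρ_μ)_μ` is a list of all irreducible projective representations with factor system `b` up to
equivalence, each equivalence class occurring exactly once. -/
structure IsCompleteIrrepList {Z : Type*} [Group Z] {b : Z → Z → Circle} {ι : Type*}
    (ρ : ι → ProjRep Z b) : Prop where
  irreducible : ∀ μ, (ρ μ).IsIrreducible
  inequivalent : ∀ μ ν, (ρ μ).IsEquivalent (ρ ν) → μ = ν
  complete : ∀ σ : ProjRep Z b, σ.IsIrreducible → ∃ μ, σ.IsEquivalent (ρ μ)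

variable {G : Type*} [Group G]

/-- A `β_g`-representation of `Z_g`. -/
abbrev BetaRep (α : NormalizedThreeCocycle G) (g : G) : Type _ :=
  ProjRep (Cent g) (fun h k : Cent g => beta α g h k)

/-- The compatibility of the characters across each conjugacy class:
`χ^{xgx⁻¹}_μ(xhx⁻¹) = η^g(h,x) χ^g_μ(h)` for all `g ∈ C^A`, `h ∈ Z_g`, `x ∈ G`. -/
def IsTransported {α : NormalizedThreeCocycle G} {I : ConjClasses G → Type*}
    (ρ : (A : ConjClasses G) → I A → (g : G) → g ∈ A.carrier → BetaRep α g) : Prop :=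
  ∀ (A : ConjClasses G) (μ : I A) (g : G) (hg : g ∈ A.carrier) (h : Cent g) (x : G),
    (ρ A μ (x * g * x⁻¹) (conj_mem_carrier hg x)).character (conjCent x h) =
      (eta α g h x : ℂ) * (ρ A μ g hg).character h

end Representations

section Torus

/-- An assignment `([13], [12], [14])` of group elements to the three edges of the torus made of
the two triangles `124` and `134`, with `[12]` identified with `[34]` and `[13]` with `[24]` (so
that all four corners are one and the same vertex). -/
abbrev Config (G : Type*) : Type _ := G × G × G

/-- The Hilbert space with the assignments as orthonormal basis. -/
abbrev TorusSpace (G : Type*) [Fintype G] : Type _ := EuclideanSpace ℂ (Config G)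

variable {G : Type*} [Group G] [Fintype G]

/-- The basis vector of an assignment. -/
noncomputable def configKet (c : Config G) : TorusSpace G :=
  EuclideanSpace.basisFun (Config G) ℂ c

/-- The linear operator with prescribed values on the basis vectors. -/
noncomputable def opOfBasis (F : Config G → TorusSpace G) : TorusSpace G →ₗ[ℂ] TorusSpace G :=
  (EuclideanSpace.basisFun (Config G) ℂ).toBasis.constr ℂ F

/-- The vector `|g,h⟩`, that is `[13] = g`, `[12] = h`, `[14] = gh`. -/
noncomputable def ket (g h : G) : TorusSpace G := configKet (g, h, g * h)

open Classical in
/-- The face operator of the triangle `124`: the projection to `[12][24][41] = 1`. -/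
noncomputable def face124 : TorusSpace G →ₗ[ℂ] TorusSpace G :=
  opOfBasis fun c : Config G =>
    if c.2.1 * c.1 * c.2.2⁻¹ = 1 then configKet c else 0

open Classical in
/-- The face operator of the triangle `134`: the projection to `[13][34][41] = 1`. -/
noncomputable def face134 : TorusSpace G →ₗ[ℂ] TorusSpace G :=
  opOfBasis fun c : Config G =>
    if c.1 * c.2.1 * c.2.2⁻¹ = 1 then configKet c else 0

/-- With `[1'1] = [2'2] = [3'3] = [4'4] = x`, the phase
`α([13],[34'],[4'4]) α([12],[24'],[4'4])⁻¹ α([13'],[3'3],[34'])⁻¹ α([12'],[2'2],[24'])`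
`α([1'1],[13'],[3'4']) α([1'1],[12'],[2'4'])⁻¹` for `[13] = [24] = g` and `[12] = [34] = h`. -/
noncomputable def vertexPhase (α : NormalizedThreeCocycle G) (x g h : G) : Circle :=
  α g (h * x⁻¹) x * (α h (g * x⁻¹) x)⁻¹ *
    (α (g * x⁻¹) x (h * x⁻¹))⁻¹ * α (h * x⁻¹) x (g * x⁻¹) *
    α x (g * x⁻¹) (x * h * x⁻¹) * (α x (h * x⁻¹) (x * g * x⁻¹))⁻¹

/-- The operator `A^x` at the only vertex. Only its action on assignments that satisfy both face
constraints, `A^x|g,h⟩ = vertexPhase x g h |xgx⁻¹,xhx⁻¹⟩`, matters for `groundSpace`. -/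
noncomputable def vertexOp (α : NormalizedThreeCocycle G) (x : G) :
    TorusSpace G →ₗ[ℂ] TorusSpace G :=
  opOfBasis fun c : Config G =>
    (vertexPhase α x c.1 c.2.1 : ℂ) •
      configKet (x * c.1 * x⁻¹, x * c.2.1 * x⁻¹, x * c.2.2 * x⁻¹)

/-- `A = |G|⁻¹ ∑ₓ A^x`. -/
noncomputable def vertexAverage (α : NormalizedThreeCocycle G) :
    TorusSpace G →ₗ[ℂ] TorusSpace G :=
  (Fintype.card G : ℂ)⁻¹ • ∑ x : G, vertexOp α x

/-- The ground state projector `P⁰ = (∏_f B_f) (∏_v A_v)`. -/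
noncomputable def groundProjector (α : NormalizedThreeCocycle G) :
    TorusSpace G →ₗ[ℂ] TorusSpace G :=
  face124 ∘ₗ face134 ∘ₗ vertexAverage α

/-- The torus ground space `{Φ | P⁰ Φ = Φ}`. -/
noncomputable def groundSpace (α : NormalizedThreeCocycle G) : Submodule ℂ (TorusSpace G) :=
  LinearMap.eqLocus (groundProjector α) LinearMap.id

open Classical in
/-- `|A,μ⟩ = |G|^{-1/2} ∑_{g ∈ C^A, h ∈ Z_g} χ^g(h) |g,h⟩`, for a family `ρ^g`, `g ∈ C^A`, of
`β_g`-representations with characters `χ^g`. -/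
noncomputable def classKet {α : NormalizedThreeCocycle G} (A : ConjClasses G)
    (ρ : (g : G) → g ∈ A.carrier → BetaRep α g) : TorusSpace G :=
  ((Real.sqrt (Fintype.card G))⁻¹ : ℂ) •
    ∑ g : A.carrier, ∑ h : Cent (g : G), (ρ g g.2).character h • ket (g : G) (h : G)

end Torus

end TQD

/-! Slanting α once gives β, a 2-cocycle on the groupoid of G acting on itself by conjugation
(`beta_cocycle`). Slanting again gives η, a 1-cocycle on the groupoid of commuting pairs
(`eta_mul`), and on such pairs the phase of A^x is exactly η (`vertexPhase_eq_eta`). Hence the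
vertex operators compose on flat assignments, and a ground state is a function on commuting pairs
that picks up η under simultaneous conjugation (`mem_groundSpace_iff`).

Such a function is determined by its restrictions to the pairs (g^A, h) with h in Z_{g^A}
(`eq_zero_of_mem_groundSpace`), and each restriction obeys the conjugation law of projective
characters. Twisted Frobenius theory finishes the analysis over one centralizer: Schur's lemma makes
irreducible characters orthogonal, and the twisted regular representation shows that they span
(`IsCompleteIrrepList.span_character`). A twisted class function vanishes at nonregular elements and
is free at one point of each regular class, which counts the labels (`IsCompleteIrrepList.card_eq`).

Representations move from g to xgx⁻¹ by conjugating and multiplying by η (`eta_mul_eta_mul_beta`).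
Two conjugators with the same effect on g^A differ by an element of Z_{g^A}, which acts on
characters by the same η; hence (*) (`isTransported_transport`). Finally |C^A| |Z_{g^A}| = |G|
accounts for the factor |G|^{-1/2}. -/

namespace TQD

/-! ### Cocycle identities for β, η and the vertex phase -/

section Cocycle

variable {G : Type*} [Group G]

/-- In additive notation an identity between phases becomes an integer combination of cocycle
relations, which `abel` can check. -/
theorem NormalizedThreeCocycle.cocycle_additive (α : NormalizedThreeCocycle G) (a b c d : G) :
    Additive.ofMul (α b c d) - Additive.ofMul (α (a * b) c d) + Additive.ofMul (α a (b * c) d) -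
      Additive.ofMul (α a b (c * d)) + Additive.ofMul (α a b c) = 0 := by
  have h := congrArg Additive.ofMul (α.cocycle a b c d)
  simpa only [ofMul_mul, ofMul_inv, ofMul_one, ← sub_eq_add_neg] using h

/-- Naming the conjugates a₁, a₂ by commutation relations avoids words in inverses, so that
instances of the cocycle relation match term by term. -/
theorem beta_eq (α : NormalizedThreeCocycle G) {a b c a₁ a₂ : G} (h₁ : a * b = b * a₁)
    (h₂ : a₁ * c = c * a₂) : beta α a b c = α a b c * α b c a₂ / α b a₁ c := by
  have e₁ : a₁ = b⁻¹ * a * b := by rw [mul_assoc, h₁, inv_mul_cancel_left]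
  have e₂ : a₂ = c⁻¹ * b⁻¹ * a * b * c := by
    rw [← inv_mul_cancel_left c a₂, ← h₂, e₁]; group
  rw [beta, ← e₁, ← e₂]

theorem beta_one_left (α : NormalizedThreeCocycle G) (a c : G) : beta α a 1 c = 1 := by
  simp [beta, α.one_left, α.one_mid]

theorem beta_one_right (α : NormalizedThreeCocycle G) (a b : G) : beta α a b 1 = 1 := by
  simp [beta, α.one_mid, α.one_right]

/-- `β` is a `2`-cocycle on the action groupoid of `G` acting on itself by conjugation. -/
theorem beta_cocycle (α : NormalizedThreeCocycle G) {a x a₁ : G} (y z : G)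
    (h₁ : a * x = x * a₁) :
    beta α a x y * beta α a (x * y) z = beta α a x (y * z) * beta α a₁ y z := by
  obtain ⟨a₂, h₂⟩ : ∃ a₂, a₁ * y = y * a₂ := ⟨y⁻¹ * a₁ * y, by group⟩
  obtain ⟨a₃, h₃⟩ : ∃ a₃, a₂ * z = z * a₃ := ⟨z⁻¹ * a₂ * z, by group⟩
  have h₁₂ : a * (x * y) = x * y * a₂ := by rw [← mul_assoc, h₁, mul_assoc, h₂, mul_assoc]
  have h₂₃ : a₁ * (y * z) = y * z * a₃ := by rw [← mul_assoc, h₂, mul_assoc, h₃, mul_assoc]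
  rw [beta_eq α h₁ h₂, beta_eq α h₁₂ h₃, beta_eq α h₁ h₂₃, beta_eq α h₂ h₃]
  apply Additive.ofMul.injective
  -- The four relations come from inserting the label a, suitably conjugated, at each of the four
  -- positions in the word x, y, z.
  have c₁ := α.cocycle_additive a x y z
  have c₂ := α.cocycle_additive x a₁ y z
  have c₃ := α.cocycle_additive x y a₂ z
  have c₄ := α.cocycle_additive x y z a₃
  rw [h₁] at c₁
  rw [h₂] at c₂
  rw [h₃] at c₃
  simp only [ofMul_mul, ofMul_div]
  linear_combination (norm := abel) c₁ - c₂ + c₃ - c₄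

/-- The commutation factor `η`, for an arbitrary factorisation `h y = y h'` with `y = x⁻¹`. -/
theorem eta_eq (α : NormalizedThreeCocycle G) {g h h' x y : G} (hy : y = x⁻¹)
    (hh : h * y = y * h') : eta α g h x = beta α g y h' / beta α g h y := by
  have e : h' = x * h * x⁻¹ := by
    rw [← inv_mul_cancel_left y h', ← hh, hy]; group
  rw [eta, ← e, ← hy]

theorem eta_one (α : NormalizedThreeCocycle G) (g h : G) : eta α g h 1 = 1 := by
  simp [eta, beta_one_left, beta_one_right]

/-- This makes the vertex operators on flat assignments multiply like G; it comes from the β-cocycle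
relation with h inserted at the three positions around y⁻¹, x⁻¹. -/
theorem eta_mul (α : NormalizedThreeCocycle G) {g h : G} (hgh : g * h = h * g) (x y : G) :
    eta α g h (x * y) = eta α (y * g * y⁻¹) (y * h * y⁻¹) x * eta α g h y := by
  obtain ⟨u, hu⟩ : ∃ u, u = x⁻¹ := ⟨_, rfl⟩
  obtain ⟨v, hv⟩ : ∃ v, v = y⁻¹ := ⟨_, rfl⟩
  obtain ⟨g₁, hg₁⟩ : ∃ g₁, g₁ = y * g * y⁻¹ := ⟨_, rfl⟩
  obtain ⟨h₁, hh₁⟩ : ∃ h₁, h₁ = y * h * y⁻¹ := ⟨_, rfl⟩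
  obtain ⟨h₂, hh₂⟩ : ∃ h₂, h₁ * u = u * h₂ := ⟨u⁻¹ * h₁ * u, by group⟩
  have eg : g * v = v * g₁ := by rw [hv, hg₁]; group
  have eh : h * v = v * h₁ := by rw [hv, hh₁]; group
  have e₂ : h * (v * u) = v * u * h₂ := by rw [← mul_assoc, eh, mul_assoc, hh₂, mul_assoc]
  have evu : v * u = (x * y)⁻¹ := by rw [hu, hv, mul_inv_rev]
  rw [← hg₁, ← hh₁, eta_eq α evu e₂, eta_eq α hu hh₂, eta_eq α hv eh]
  have c₁ := congrArg Additive.ofMul (beta_cocycle α v u hgh)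
  have c₂ := congrArg Additive.ofMul (beta_cocycle α h₁ u eg)
  have c₃ := congrArg Additive.ofMul (beta_cocycle α u h₂ eg)
  rw [eh] at c₁
  rw [hh₂] at c₂
  apply Additive.ofMul.injective
  simp only [ofMul_mul, ofMul_div] at c₁ c₂ c₃ ⊢
  linear_combination (norm := abel) c₁ - c₂ + c₃

theorem vertexPhase_eq_eta (α : NormalizedThreeCocycle G) {g h : G} (hgh : g * h = h * g) (x : G) :
    vertexPhase α x g h = eta α g h x := by
  obtain ⟨y, hy⟩ : ∃ y, y = x⁻¹ := ⟨_, rfl⟩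
  obtain ⟨g', hg'⟩ : ∃ g', g' = x * g * x⁻¹ := ⟨_, rfl⟩
  obtain ⟨h', hh'⟩ : ∃ h', h' = x * h * x⁻¹ := ⟨_, rfl⟩
  have eg : g * y = y * g' := by rw [hy, hg']; group
  have eh : h * y = y * h' := by rw [hy, hh']; group
  have exy : x * y = 1 := by rw [hy, mul_inv_cancel]
  have eyx : y * x = 1 := by rw [hy, inv_mul_cancel]
  have exg : x * (y * g') = g' := by rw [← mul_assoc, exy, one_mul]
  have exh : x * (y * h') = h' := by rw [← mul_assoc, exy, one_mul]
  have egh' : g' * h' = h' * g' := by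
    rw [hg', hh']
    calc x * g * x⁻¹ * (x * h * x⁻¹) = x * (g * h) * x⁻¹ := by group
      _ = x * (h * g) * x⁻¹ := by rw [hgh]
      _ = _ := by group
  rw [eta_eq α hy eh, beta_eq α eg egh', beta_eq α hgh eg, vertexPhase, ← hg', ← hh', ← hy, eg, eh]
  have c₁ := α.cocycle_additive g h y x
  have c₂ := α.cocycle_additive h g y x
  have c₃ := α.cocycle_additive x y g' h'
  have c₄ := α.cocycle_additive x y h' g'
  have c₅ := α.cocycle_additive h y x (y * g')
  have c₆ := α.cocycle_additive g y x (y * h')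
  -- `c₇` and `c₈` trade α(y,x,y·) for α(x,y,·); their common term α(y,x,y) cancels.
  have c₇ := α.cocycle_additive y x y g'
  have c₈ := α.cocycle_additive y x y h'
  apply Additive.ofMul.injective
  simp only [hgh, eg, eh, exy, eyx, exg, exh, egh', α.one_left, α.one_mid, α.one_right,
    ofMul_one, ofMul_mul, ofMul_inv, ofMul_div] at c₁ c₂ c₃ c₄ c₅ c₆ c₇ c₈ ⊢
  linear_combination (norm := abel) c₁ - c₂ + c₃ - c₄ - c₅ + c₆ - c₇ + c₈

end Cocycle

/-! ### Schur's lemma and orthogonality of projective characters -/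

section ProjectiveRepresentations

open Matrix
open scoped ComplexOrder

/-- The factor relating `ρ(xhx⁻¹)` to the conjugate of `ρ(h)` in a projective representation. -/
noncomputable def conjFactor {Z : Type*} [Group Z] (b : Z → Z → Circle) (h x : Z) : Circle :=
  b x⁻¹ (x * h * x⁻¹) / b h x⁻¹

namespace ProjRep

variable {Z : Type*} [Group Z] {b : Z → Z → Circle}

theorem mat_mul (ρ : ProjRep Z b) (x y : Z) :
    ρ.mat x * ρ.mat y = (b x y : ℂ) • ρ.mat (x * y) := ρ.map_mul x y

theorem isUnit_det (ρ : ProjRep Z b) (x : Z) : IsUnit (ρ.mat x).det :=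
  (Matrix.isUnit_iff_isUnit_det _).1 (ρ.toFun x).isUnit

theorem mulVec_injective (ρ : ProjRep Z b) (x : Z) :
    Function.Injective (ρ.mat x).mulVec :=
  Matrix.mulVec_injective_of_isUnit (ρ.toFun x).isUnit

theorem inv_mat_mul (ρ : ProjRep Z b) (k h : Z) :
    (ρ.mat (k * h))⁻¹ * ρ.mat k = (b k h : ℂ) • (ρ.mat h)⁻¹ := by
  have e : ρ.mat k = (b k h : ℂ) • (ρ.mat (k * h) * (ρ.mat h)⁻¹) := by
    rw [← Matrix.smul_mul, ← ρ.mat_mul, Matrix.mul_nonsing_inv_cancel_right _ _ (ρ.isUnit_det h)]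
  rw [e, Matrix.mul_smul, Matrix.nonsing_inv_mul_cancel_left _ _ (ρ.isUnit_det _)]

theorem mat_mul_conj (ρ : ProjRep Z b) (h x : Z) :
    ρ.mat x⁻¹ * ρ.mat (x * h * x⁻¹) =
      (conjFactor b h x : ℂ) • (ρ.mat h * ρ.mat x⁻¹) := by
  rw [mat_mul, mat_mul, smul_smul]
  have e : x⁻¹ * (x * h * x⁻¹) = h * x⁻¹ := by group
  rw [e, ← Circle.coe_mul, conjFactor, div_mul_cancel]

theorem mat_conj (ρ : ProjRep Z b) (h x : Z) :
    ρ.mat (x * h * x⁻¹) =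
      (conjFactor b h x : ℂ) • ((ρ.mat x⁻¹)⁻¹ * ρ.mat h * ρ.mat x⁻¹) := by
  rw [mul_assoc (ρ.mat x⁻¹)⁻¹, ← Matrix.mul_smul, ← mat_mul_conj,
    Matrix.nonsing_inv_mul_cancel_left _ _ (ρ.isUnit_det _)]

theorem character_conj (ρ : ProjRep Z b) (h x : Z) :
    ρ.character (x * h * x⁻¹) = (conjFactor b h x : ℂ) * ρ.character h := by
  rw [character, mat_conj, Matrix.trace_smul, mul_assoc, Matrix.trace_mul_comm,
    mul_assoc, Matrix.mul_nonsing_inv _ (ρ.isUnit_det _), mul_one, smul_eq_mul, character]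

theorem IsEquivalent.symm {ρ σ : ProjRep Z b} (h : ρ.IsEquivalent σ) : σ.IsEquivalent ρ := by
  obtain ⟨f, hf⟩ := h
  refine ⟨f.symm, fun z v => f.injective ?_⟩
  rw [hf, f.apply_symm_apply, f.apply_symm_apply]

theorem IsEquivalent.character_eq {ρ σ : ProjRep Z b} (h : ρ.IsEquivalent σ) (z : Z) :
    ρ.character z = σ.character z := by
  obtain ⟨f, hf⟩ := h
  have e : Matrix.toLin' (σ.mat z) = f.conj (Matrix.toLin' (ρ.mat z)) := by
    ext1 v
    ext1
    simp [LinearEquiv.conj_apply, hf]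
  rw [character, character, ← Matrix.trace_toLin'_eq, ← Matrix.trace_toLin'_eq (σ.mat z), e,
    LinearMap.trace_conj']

/-- Schur's lemma for two representations. -/
theorem IsIrreducible.eq_zero_or_isEquivalent {ρ σ : ProjRep Z b} (hρ : ρ.IsIrreducible)
    (hσ : σ.IsIrreducible) (f : (Fin ρ.dim → ℂ) →ₗ[ℂ] (Fin σ.dim → ℂ))
    (hf : ∀ z v, f (ρ.mat z *ᵥ v) = σ.mat z *ᵥ f v) : f = 0 ∨ ρ.IsEquivalent σ := by
  rcases hρ.2 (LinearMap.ker f) (fun z v hv => by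
    rw [LinearMap.mem_ker] at hv ⊢
    rw [hf, hv, Matrix.mulVec_zero]) with hk | hk
  · rcases hσ.2 (LinearMap.range f) (by
      rintro z _ ⟨v, rfl⟩
      exact ⟨_, hf z v⟩) with hr | hr
    · exact Or.inl (LinearMap.range_eq_bot.1 hr)
    · exact Or.inr ⟨LinearEquiv.ofBijective f
        ⟨LinearMap.ker_eq_bot.1 hk, LinearMap.range_eq_top.1 hr⟩, hf⟩
  · exact Or.inl (LinearMap.ker_eq_top.1 hk)

/-- Schur's lemma for endomorphisms. -/
theorem IsIrreducible.eq_smul_one {ρ : ProjRep Z b} (hρ : ρ.IsIrreducible)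
    (M : Matrix (Fin ρ.dim) (Fin ρ.dim) ℂ) (hM : ∀ z, ρ.mat z * M = M * ρ.mat z) :
    ∃ c : ℂ, M = c • 1 := by
  have : Nonempty (Fin ρ.dim) := ⟨⟨0, hρ.1⟩⟩
  obtain ⟨c, hc⟩ := Module.End.exists_eigenvalue (Matrix.toLin' M)
  refine ⟨c, ?_⟩
  rcases hρ.2 (Module.End.eigenspace (Matrix.toLin' M) c) (fun z v hv => by
    rw [Module.End.mem_eigenspace_iff, Matrix.toLin'_apply] at hv ⊢
    rw [Matrix.mulVec_mulVec, ← hM, ← Matrix.mulVec_mulVec, hv, Matrix.mulVec_smul]) with h | h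
  · exact absurd h hc
  · apply Matrix.toLin'.injective
    ext1 v
    ext1
    have hv : Pi.single v (1 : ℂ) ∈ Module.End.eigenspace (Matrix.toLin' M) c := h ▸ trivial
    rw [Module.End.mem_eigenspace_iff] at hv
    simpa using hv

section Finite

variable [Fintype Z]

/-- Averaging a matrix to an intertwiner. -/
noncomputable def average (ρ σ : ProjRep Z b) (X : Matrix (Fin ρ.dim) (Fin σ.dim) ℂ) :
    Matrix (Fin ρ.dim) (Fin σ.dim) ℂ :=
  ∑ h : Z, ρ.mat h * X * (σ.mat h)⁻¹

/-- The average is formed with the matrix inverse of σ(h), not with σ(h⁻¹). After the shift h ↦ kh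
both sides then carry the same factor b(k,h), and no cocycle condition on b is needed. -/
theorem mat_mul_average (ρ σ : ProjRep Z b) (X : Matrix (Fin ρ.dim) (Fin σ.dim) ℂ) (k : Z) :
    ρ.mat k * average ρ σ X = average ρ σ X * σ.mat k := by
  rw [average, Matrix.mul_sum, Matrix.sum_mul,
    ← Equiv.sum_comp (Equiv.mulLeft k) fun h => ρ.mat h * X * (σ.mat h)⁻¹ * σ.mat k]
  refine Finset.sum_congr rfl fun h _ => ?_
  rw [Equiv.coe_mulLeft, Matrix.mul_assoc (_ * X), inv_mat_mul, ← Matrix.mul_assoc,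
    ← Matrix.mul_assoc, mat_mul,
    Matrix.mul_smul, Matrix.smul_mul, Matrix.smul_mul]

/-- Weyl's unitary trick: ρ need not be unitary, but since |b| = 1 the positive definite form H is
invariant, so ρ(k)⁻¹ is conjugate to the adjoint of ρ(k). -/
theorem trace_inv_mat (ρ : ProjRep Z b) (k : Z) :
    (ρ.mat k)⁻¹.trace = star (ρ.character k) := by
  set H : Matrix (Fin ρ.dim) (Fin ρ.dim) ℂ := ∑ h : Z, (ρ.mat h)ᴴ * ρ.mat h with hH
  have hpos : H.PosDef := by
    apply Matrix.posDef_sum Finset.univ_nonempty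
    intro h _
    exact Matrix.PosDef.conjTranspose_mul_self _ (ρ.mulVec_injective h)
  have hdet : IsUnit H.det := (Matrix.isUnit_iff_isUnit_det _).1 hpos.isUnit
  have hinv : (ρ.mat k)ᴴ * H * ρ.mat k = H := by
    rw [hH, Matrix.mul_sum, Matrix.sum_mul]
    conv_rhs => rw [← Equiv.sum_comp (Equiv.mulRight k)]
    refine Finset.sum_congr rfl fun h _ => ?_
    have e : (ρ.mat k)ᴴ * ((ρ.mat h)ᴴ * ρ.mat h) * ρ.mat k =
        (ρ.mat h * ρ.mat k)ᴴ * (ρ.mat h * ρ.mat k) := by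
      rw [Matrix.conjTranspose_mul]; simp only [mul_assoc]
    rw [e, mat_mul, Matrix.conjTranspose_smul, Matrix.smul_mul, Matrix.mul_smul, smul_smul]
    have e' : star (b h k : ℂ) * (b h k : ℂ) = 1 := by
      rw [Complex.star_def, ← Circle.coe_inv_eq_conj, ← Circle.coe_mul, inv_mul_cancel,
        Circle.coe_one]
    rw [e', one_smul, Equiv.coe_mulRight]
  have e : (ρ.mat k)⁻¹ = H⁻¹ * ((ρ.mat k)ᴴ * H) := by
    apply Matrix.inv_eq_left_inv
    rw [mul_assoc, hinv, Matrix.nonsing_inv_mul _ hdet]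
  rw [e, Matrix.trace_mul_comm, mul_assoc, Matrix.mul_nonsing_inv _ hdet, mul_one,
    Matrix.trace_conjTranspose, character]

/-- Reduces the pairing of characters to averages of elementary matrices, which are intertwiners and
so fall under Schur's lemma. -/
theorem sum_character_mul_trace_inv (ρ σ : ProjRep Z b) :
    ∑ h : Z, ρ.character h * star (σ.character h) =
      ∑ i, ∑ j, average ρ σ (Matrix.single i j 1) i j := by
  have e : ∀ i j, average ρ σ (Matrix.single i j 1) i j =
      ∑ h : Z, ρ.mat h i i * (σ.mat h)⁻¹ j j := by
    intro i j
    rw [average, Matrix.sum_apply]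
    refine Finset.sum_congr rfl fun h _ => ?_
    rw [Matrix.mul_apply, Finset.sum_eq_single j]
    · rw [Matrix.mul_single_apply_same, mul_one]
    · intro k _ hk
      rw [Matrix.mul_single_apply_of_ne _ _ _ _ _ hk, zero_mul]
    · simp
  simp_rw [e, ← trace_inv_mat, character, Matrix.trace, Matrix.diag_apply, Finset.sum_mul_sum]
  rw [Finset.sum_comm]
  exact Finset.sum_congr rfl fun i _ => Finset.sum_comm

theorem sum_character_mul_star_of_not_isEquivalent {ρ σ : ProjRep Z b} (hρ : ρ.IsIrreducible)
    (hσ : σ.IsIrreducible) (h : ¬ ρ.IsEquivalent σ) :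
    ∑ z : Z, ρ.character z * star (σ.character z) = 0 := by
  rw [sum_character_mul_trace_inv]
  refine Finset.sum_eq_zero fun i _ => Finset.sum_eq_zero fun j _ => ?_
  have key : Matrix.toLin' (average ρ σ (Matrix.single i j 1)) = 0 := by
    rcases hσ.eq_zero_or_isEquivalent hρ (Matrix.toLin' (average ρ σ (Matrix.single i j 1)))
      (fun z v => by
        rw [Matrix.toLin'_apply, Matrix.toLin'_apply, Matrix.mulVec_mulVec, Matrix.mulVec_mulVec,
          mat_mul_average]) with h' | h'
    · exact h'
    · exact absurd h'.symm h
  rw [(LinearEquiv.map_eq_zero_iff _).1 key, Matrix.zero_apply]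

theorem sum_character_mul_star_self {ρ : ProjRep Z b} (hρ : ρ.IsIrreducible) :
    ∑ z : Z, ρ.character z * star (ρ.character z) = Fintype.card Z := by
  rw [sum_character_mul_trace_inv]
  have hn : (ρ.dim : ℂ) ≠ 0 := Nat.cast_ne_zero.2 hρ.1.ne'
  have key : ∀ i j, average ρ ρ (Matrix.single i j 1) i j =
      if i = j then (Fintype.card Z : ℂ) / ρ.dim else 0 := by
    intro i j
    obtain ⟨c, hc⟩ := hρ.eq_smul_one _ (mat_mul_average ρ ρ (Matrix.single i j 1))
    -- The trace determines the scalar c, because every summand of the average is a conjugate of the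
    -- elementary matrix.
    have ht : (average ρ ρ (Matrix.single i j 1)).trace =
        Fintype.card Z * (Matrix.single i j (1 : ℂ)).trace := by
      rw [average, Matrix.trace_sum, Finset.sum_congr rfl fun h _ => ?_, Finset.sum_const,
        Finset.card_univ, nsmul_eq_mul]
      rw [Matrix.trace_mul_comm, ← mul_assoc, Matrix.nonsing_inv_mul _ (ρ.isUnit_det _), one_mul]
    rw [hc, Matrix.trace_smul, Matrix.trace_one, Fintype.card_fin, smul_eq_mul] at ht
    rw [hc, Matrix.smul_apply, Matrix.one_apply, smul_eq_mul]
    split_ifs with hij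
    · subst hij
      rw [Matrix.trace_single_eq_same, mul_one] at ht
      rw [mul_one, ← ht, mul_div_cancel_right₀ _ hn]
    · rw [mul_zero]
  simp_rw [key, Finset.sum_ite_eq, Finset.mem_univ, if_true, Finset.sum_const, Finset.card_univ,
    Fintype.card_fin, nsmul_eq_mul]
  rw [mul_div_cancel₀ _ hn]

end Finite

end ProjRep

end ProjectiveRepresentations

/-! ### Complete reducibility and completeness of the characters -/

section Completeness

open Matrix

namespace ProjRep

variable {Z : Type*} [Group Z] {b : Z → Z → Circle}

section OfOperators

variable {V : Type*} [AddCommGroup V] [Module ℂ V] [FiniteDimensional ℂ V]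

/-- The matrix form of a projective representation on a finite-dimensional vector space. -/
noncomputable def ofOperators (b : Z → Z → Circle) (T : Z → V →ₗ[ℂ] V)
    (hinj : ∀ z, Function.Injective (T z))
    (hT : ∀ x y v, T x (T y v) = (b x y : ℂ) • T (x * y) v) : ProjRep Z b where
  dim := Module.finrank ℂ V
  toFun z := Units.map (LinearMap.toMatrixAlgEquiv (Module.finBasis ℂ V)).toMonoidHom
    ((Module.End.isUnit_iff _).2
      ⟨hinj z, LinearMap.injective_iff_surjective.1 (hinj z)⟩).unit
  map_mul x y := by
    change LinearMap.toMatrixAlgEquiv (Module.finBasis ℂ V) (T x) *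
      LinearMap.toMatrixAlgEquiv (Module.finBasis ℂ V) (T y) =
      (b x y : ℂ) • LinearMap.toMatrixAlgEquiv (Module.finBasis ℂ V) (T (x * y))
    rw [← _root_.map_mul, show T x * T y = (b x y : ℂ) • T (x * y) from LinearMap.ext (hT x y),
      map_smul]

theorem ofOperators_mulVec (T : Z → V →ₗ[ℂ] V)
    (hinj : ∀ z, Function.Injective (T z))
    (hT : ∀ x y v, T x (T y v) = (b x y : ℂ) • T (x * y) v) (z : Z) (v : V) :
    (ofOperators b T hinj hT).mat z *ᵥ (Module.finBasis ℂ V).equivFun v =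
      (Module.finBasis ℂ V).equivFun (T z v) :=
  LinearMap.toMatrix_mulVec_repr (Module.finBasis ℂ V) (Module.finBasis ℂ V) (T z) v

end OfOperators

/-- The representation on an invariant subspace. -/
noncomputable def restrict (ρ : ProjRep Z b) (W : Submodule ℂ (Fin ρ.dim → ℂ))
    (hW : ∀ z : Z, ∀ v ∈ W, ρ.mat z *ᵥ v ∈ W) : ProjRep Z b :=
  ofOperators b (fun z => (ρ.mat z).mulVecLin.restrict (hW z))
    (fun z v w h => Subtype.ext (ρ.mulVec_injective z (congrArg Subtype.val h)))
    (fun x y v => Subtype.ext (by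
      change ρ.mat x *ᵥ (ρ.mat y *ᵥ (v : Fin ρ.dim → ℂ)) = (b x y : ℂ) • (ρ.mat (x * y) *ᵥ v)
      rw [Matrix.mulVec_mulVec, mat_mul, Matrix.smul_mulVec]))

theorem restrict_mulVec (ρ : ProjRep Z b) (W : Submodule ℂ (Fin ρ.dim → ℂ))
    (hW : ∀ z : Z, ∀ v ∈ W, ρ.mat z *ᵥ v ∈ W) (z : Z) (w : W) :
    (ρ.restrict W hW).mat z *ᵥ (Module.finBasis ℂ W).equivFun w =
      (Module.finBasis ℂ W).equivFun ⟨ρ.mat z *ᵥ w, hW z w w.2⟩ :=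
  ofOperators_mulVec _ _ _ z w

/-- Minimality is what the induction in `integrate_mulVec_eq_zero` supplies; it passes to the
coordinate space through the basis chosen for W. -/
theorem restrict_isIrreducible (ρ : ProjRep Z b) (W : Submodule ℂ (Fin ρ.dim → ℂ))
    (hW : ∀ z : Z, ∀ v ∈ W, ρ.mat z *ᵥ v ∈ W) (h0 : W ≠ ⊥)
    (hmin : ∀ U ≤ W, (∀ z : Z, ∀ v ∈ U, ρ.mat z *ᵥ v ∈ U) → U = ⊥ ∨ U = W) :
    (ρ.restrict W hW).IsIrreducible := by
  refine ⟨?_, fun U hU => ?_⟩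
  · have : Nontrivial W := Submodule.nontrivial_iff_ne_bot.2 h0
    exact Module.finrank_pos
  · set e := (Module.finBasis ℂ W).equivFun with he
    rcases hmin ((U.comap e.toLinearMap).map W.subtype) (Submodule.map_subtype_le _ _) (by
      rintro z _ ⟨w, hw, rfl⟩
      refine ⟨⟨ρ.mat z *ᵥ w, hW z w w.2⟩, ?_, rfl⟩
      change e _ ∈ U
      rw [he, ← restrict_mulVec]
      exact hU z _ hw) with h | h
    · left
      rw [eq_bot_iff]
      intro u hu
      have hu' : ((e.symm u : W) : Fin ρ.dim → ℂ) ∈ (U.comap e.toLinearMap).map W.subtype :=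
        ⟨e.symm u, Eq.mpr (congrArg (· ∈ U) (e.apply_symm_apply u)) hu, rfl⟩
      rw [h, Submodule.mem_bot, Submodule.coe_eq_zero] at hu'
      exact e.symm.map_eq_zero_iff.1 hu'
    · right
      rw [eq_top_iff]
      intro u _
      have hu : ((e.symm u : W) : Fin ρ.dim → ℂ) ∈ (U.comap e.toLinearMap).map W.subtype := by
        rw [h]; exact (e.symm u).2
      obtain ⟨w, hw, hwu⟩ := hu
      rw [show w = e.symm u from Subtype.ext hwu] at hw
      exact e.apply_symm_apply u ▸ hw

section Finite

variable [Fintype Z]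

/-- Maschke's theorem. -/
theorem exists_invariant_isCompl (ρ : ProjRep Z b) (U : Submodule ℂ (Fin ρ.dim → ℂ))
    (hU : ∀ z : Z, ∀ v ∈ U, ρ.mat z *ᵥ v ∈ U) :
    ∃ K : Submodule ℂ (Fin ρ.dim → ℂ), (∀ z : Z, ∀ v ∈ K, ρ.mat z *ᵥ v ∈ K) ∧ IsCompl U K := by
  obtain ⟨U', hU'⟩ := U.exists_isCompl
  -- X is any projection onto U; its average P commutes with ρ and still projects onto U, so the
  -- kernel of P is an invariant complement.
  set X : Matrix (Fin ρ.dim) (Fin ρ.dim) ℂ := LinearMap.toMatrix' (U.projection U' hU') with hX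
  have hXv : ∀ v, X *ᵥ v = U.projection U' hU' v := fun v => by
    rw [hX, ← Matrix.toLin'_apply, Matrix.toLin'_toMatrix']
  set P := (Fintype.card Z : ℂ)⁻¹ • average ρ ρ X with hP
  have hcard : (Fintype.card Z : ℂ) ≠ 0 := Nat.cast_ne_zero.2 Fintype.card_ne_zero
  have hPv : ∀ v, P *ᵥ v =
      (Fintype.card Z : ℂ)⁻¹ • ∑ z, ρ.mat z *ᵥ (X *ᵥ ((ρ.mat z)⁻¹ *ᵥ v)) := fun v => by
    rw [hP, Matrix.smul_mulVec, average, Matrix.sum_mulVec]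
    simp only [Matrix.mulVec_mulVec, Matrix.mul_assoc]
  have hmem : ∀ v, P *ᵥ v ∈ U := fun v => by
    rw [hPv]
    refine U.smul_mem _ (U.sum_mem fun z _ => hU z _ ?_)
    rw [hXv]
    exact Submodule.projection_apply_mem _ _
  -- Invariance under ρ(z)⁻¹ follows by dimension: ρ(z) is injective on U, hence surjective.
  have hinv : ∀ z, ∀ v ∈ U, (ρ.mat z)⁻¹ *ᵥ v ∈ U := fun z v hv => by
    have hs : Function.Surjective ((ρ.mat z).mulVecLin.restrict (hU z)) :=
      LinearMap.injective_iff_surjective.1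
        (fun v w h => Subtype.ext (ρ.mulVec_injective z (congrArg Subtype.val h)))
    obtain ⟨u, hu⟩ := hs ⟨v, hv⟩
    have hu' : ρ.mat z *ᵥ u = v := congrArg Subtype.val hu
    rw [← hu', Matrix.mulVec_mulVec, Matrix.nonsing_inv_mul _ (ρ.isUnit_det z), Matrix.one_mulVec]
    exact u.2
  have hfix : ∀ v ∈ U, P *ᵥ v = v := fun v hv => by
    rw [hPv, Finset.sum_congr rfl (g := fun _ => v), Finset.sum_const, Finset.card_univ,
      ← Nat.cast_smul_eq_nsmul ℂ, smul_smul, inv_mul_cancel₀ hcard, one_smul]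
    intro z _
    rw [hXv, Submodule.projection_apply_left hU' ⟨_, hinv z v hv⟩, Matrix.mulVec_mulVec,
      Matrix.mul_nonsing_inv _ (ρ.isUnit_det z), Matrix.one_mulVec]
  refine ⟨LinearMap.ker P.mulVecLin, fun z v hv => ?_, ?_⟩
  · rw [LinearMap.mem_ker, Matrix.mulVecLin_apply] at hv ⊢
    rw [Matrix.mulVec_mulVec, hP, Matrix.smul_mul, ← mat_mul_average, ← Matrix.mul_smul, ← hP,
      ← Matrix.mulVec_mulVec, hv, Matrix.mulVec_zero]
  · refine IsCompl.of_eq ?_ ?_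
    · rw [eq_bot_iff]
      rintro v ⟨hv, hv'⟩
      rw [SetLike.mem_coe, LinearMap.mem_ker, Matrix.mulVecLin_apply, hfix v hv] at hv'
      exact hv'
    · rw [eq_top_iff]
      intro v _
      rw [← add_sub_cancel (P *ᵥ v) v]
      refine Submodule.add_mem_sup (hmem v) ?_
      rw [LinearMap.mem_ker, Matrix.mulVecLin_apply, Matrix.mulVec_sub, hfix _ (hmem v), sub_self]

/-- The operator `∑ₕ φ̄(h) ρ(h)`. -/
noncomputable def integrate (ρ : ProjRep Z b) (φ : Z → ℂ) : Matrix (Fin ρ.dim) (Fin ρ.dim) ℂ :=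
  ∑ h : Z, star (φ h) • ρ.mat h

theorem integrate_mulVec (ρ : ProjRep Z b) (φ : Z → ℂ) (v : Fin ρ.dim → ℂ) :
    ρ.integrate φ *ᵥ v = ∑ h : Z, star (φ h) • (ρ.mat h *ᵥ v) := by
  rw [integrate, Matrix.sum_mulVec]
  simp only [Matrix.smul_mulVec]

theorem integrate_ofOperators {V : Type*} [AddCommGroup V] [Module ℂ V] [FiniteDimensional ℂ V]
    (T : Z → V →ₗ[ℂ] V) (hinj : ∀ z, Function.Injective (T z))
    (hT : ∀ x y v, T x (T y v) = (b x y : ℂ) • T (x * y) v) (φ : Z → ℂ) (v : V) :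
    (ofOperators b T hinj hT).integrate φ *ᵥ (Module.finBasis ℂ V).equivFun v =
      (Module.finBasis ℂ V).equivFun (∑ h : Z, star (φ h) • T h v) := by
  refine (integrate_mulVec _ _ _).trans ?_
  rw [map_sum]
  refine Finset.sum_congr rfl fun h _ => ?_
  rw [map_smul, ← ofOperators_mulVec T hinj hT]
  rfl

end Finite

end ProjRep

/-- The functions transforming under conjugation like projective characters. -/
noncomputable def twistedClassFunctions {Z : Type*} [Group Z] (b : Z → Z → Circle) :
    Submodule ℂ (Z → ℂ) where
  carrier := {φ | ∀ h x : Z, φ (x * h * x⁻¹) = (conjFactor b h x : ℂ) * φ h}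
  add_mem' hφ hψ h x := by rw [Pi.add_apply, hφ, hψ, Pi.add_apply, mul_add]
  zero_mem' h x := by simp
  smul_mem' c φ hφ h x := by
    rw [Pi.smul_apply, hφ, Pi.smul_apply, smul_eq_mul, smul_eq_mul, mul_left_comm]

variable {Z : Type*} [Group Z] {b : Z → Z → Circle}

theorem ProjRep.character_mem (ρ : ProjRep Z b) : ρ.character ∈ twistedClassFunctions b :=
  fun h x => ρ.character_conj h x

/-- The operators of the projective regular representation. -/
noncomputable def regularOp (b : Z → Z → Circle) (x : Z) : (Z → ℂ) →ₗ[ℂ] (Z → ℂ) where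
  toFun f z := (b x (x⁻¹ * z) : ℂ) * f (x⁻¹ * z)
  map_add' f g := by ext z; simp [mul_add]
  map_smul' c f := by ext z; simp [mul_left_comm]

theorem regularOp_injective (b : Z → Z → Circle) (x : Z) :
    Function.Injective (regularOp b x) := by
  intro f g h
  ext z
  have hz := congrFun h (x * z)
  simpa [regularOp] using hz

/-- The 2-cocycle condition enters here: it is exactly what makes twisted left translation a
projective representation with factor system b. -/
theorem regularOp_mul (hb : ∀ x y z, b x y * b (x * y) z = b x (y * z) * b y z) (x y : Z)
    (f : Z → ℂ) : regularOp b x (regularOp b y f) = (b x y : ℂ) • regularOp b (x * y) f := by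
  ext z
  have h := congrArg (fun c : Circle => (c : ℂ)) (hb x y (y⁻¹ * (x⁻¹ * z)))
  rw [mul_inv_cancel_left, Circle.coe_mul, Circle.coe_mul] at h
  change (b x (x⁻¹ * z) : ℂ) * ((b y (y⁻¹ * (x⁻¹ * z)) : ℂ) * f (y⁻¹ * (x⁻¹ * z))) =
    (b x y : ℂ) * ((b (x * y) ((x * y)⁻¹ * z) : ℂ) * f ((x * y)⁻¹ * z))
  rw [_root_.mul_inv_rev, mul_assoc y⁻¹, ← mul_assoc, ← h, mul_assoc]

section Finite

variable [Fintype Z]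

/-- Under conjugation star φ(h) and ρ(h) acquire conjugate phases, which cancel. This is why the
weight is star φ and not φ. -/
theorem ProjRep.mat_mul_integrate (ρ : ProjRep Z b) {φ : Z → ℂ}
    (hφ : φ ∈ twistedClassFunctions b) (k : Z) :
    ρ.mat k * ρ.integrate φ = ρ.integrate φ * ρ.mat k := by
  obtain ⟨x, rfl⟩ : ∃ x, k = x⁻¹ := ⟨k⁻¹, (inv_inv k).symm⟩
  conv_lhs => rw [integrate, ← Equiv.sum_comp (MulAut.conj x).toEquiv]
  rw [integrate, Finset.mul_sum, Finset.sum_mul]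
  refine Finset.sum_congr rfl fun h _ => ?_
  have e : (MulAut.conj x).toEquiv h = x * h * x⁻¹ := rfl
  rw [e, Matrix.mul_smul, ρ.mat_mul_conj, hφ, smul_smul, Matrix.smul_mul, star_mul', mul_right_comm,
    Complex.star_def, ← Circle.coe_inv_eq_conj, ← Circle.coe_mul, inv_mul_cancel, Circle.coe_one,
    one_mul]

/-- By Schur the operator is a scalar, and its trace is the pairing of φ with the character. -/
theorem ProjRep.IsIrreducible.integrate_eq_zero {ρ : ProjRep Z b} (hρ : ρ.IsIrreducible)
    {φ : Z → ℂ} (hφ : φ ∈ twistedClassFunctions b)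
    (h0 : ∑ h, star (φ h) * ρ.character h = 0) : ρ.integrate φ = 0 := by
  obtain ⟨c, hc⟩ := hρ.eq_smul_one _ (ρ.mat_mul_integrate hφ)
  have ht := congrArg Matrix.trace hc
  rw [integrate, Matrix.trace_sum, Matrix.trace_smul, Matrix.trace_one, Fintype.card_fin] at ht
  simp only [Matrix.trace_smul, smul_eq_mul] at ht
  have hc0 : c = 0 := by
    have : c * (ρ.dim : ℂ) = 0 := ht.symm.trans h0
    exact (mul_eq_zero.1 this).resolve_right (Nat.cast_ne_zero.2 hρ.1.ne')
  rw [hc, hc0, zero_smul]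

/-- Induction on the dimension of an invariant subspace W: a minimal W is irreducible, and otherwise
Maschke splits W into two smaller invariant pieces. -/
theorem ProjRep.integrate_mulVec_eq_zero (ρ : ProjRep Z b) {φ : Z → ℂ}
    (hφ : φ ∈ twistedClassFunctions b)
    (h0 : ∀ σ : ProjRep Z b, σ.IsIrreducible → ∑ h, star (φ h) * σ.character h = 0) :
    ∀ (n : ℕ) (W : Submodule ℂ (Fin ρ.dim → ℂ)), (∀ z : Z, ∀ v ∈ W, ρ.mat z *ᵥ v ∈ W) →
      Module.finrank ℂ W = n → ∀ w ∈ W, ρ.integrate φ *ᵥ w = 0 := by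
  intro n
  induction n using Nat.strong_induction_on with
  | _ n ih =>
  intro W hW hn w hw
  by_cases hbot : W = ⊥
  · rw [hbot, Submodule.mem_bot] at hw
    rw [hw, Matrix.mulVec_zero]
  by_cases hmin : ∀ U ≤ W, (∀ z : Z, ∀ v ∈ U, ρ.mat z *ᵥ v ∈ U) → U = ⊥ ∨ U = W
  · have hirr := ρ.restrict_isIrreducible W hW hbot hmin
    have hz := hirr.integrate_eq_zero hφ (h0 _ hirr)
    have hz' := congrArg (fun M => M *ᵥ (Module.finBasis ℂ W).equivFun ⟨w, hw⟩) hz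
    have hz'' := (integrate_ofOperators _ _ _ φ (⟨w, hw⟩ : W)).symm.trans
      (hz'.trans (Matrix.zero_mulVec _))
    have hz₃ := congrArg Subtype.val ((LinearEquiv.map_eq_zero_iff _).1 hz'')
    rw [Submodule.coe_sum] at hz₃
    rw [integrate_mulVec]
    exact hz₃
  · push Not at hmin
    obtain ⟨U, hUW, hU, hU0, hUne⟩ := hmin
    obtain ⟨K, hK, hUK⟩ := ρ.exists_invariant_isCompl U hU
    have hsup : U ⊔ K ⊓ W = W := by
      rw [← sup_inf_assoc_of_le K hUW, hUK.sup_eq_top, top_inf_eq]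
    have hlt : K ⊓ W < W := by
      refine lt_of_le_of_ne inf_le_right fun h => hU0 ?_
      have : U ≤ K := hUW.trans (inf_eq_right.1 h)
      exact (hUK.disjoint.eq_bot_of_le this)
    rw [← hsup] at hw
    obtain ⟨u, hu, k, hk, rfl⟩ := Submodule.mem_sup.1 hw
    rw [Matrix.mulVec_add,
      ih _ (hn ▸ Submodule.finrank_lt_finrank_of_lt (lt_of_le_of_ne hUW hUne)) U hU rfl u hu,
      ih _ (hn ▸ Submodule.finrank_lt_finrank_of_lt hlt) (K ⊓ W)
        (fun z v hv => ⟨hK z v hv.1, hW z v hv.2⟩) rfl k hk, add_zero]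

/-- In the regular representation the integrated operator sends δ₁ to ∑ star φ(h) b(h,1) δ_h. Since
it is zero, all coefficients vanish, and b(h,1) ≠ 0. -/
theorem eq_zero_of_forall_character (hb : ∀ x y z, b x y * b (x * y) z = b x (y * z) * b y z)
    {φ : Z → ℂ} (hφ : φ ∈ twistedClassFunctions b)
    (h0 : ∀ σ : ProjRep Z b, σ.IsIrreducible → ∑ h, star (φ h) * σ.character h = 0) : φ = 0 := by
  classical
  have hz := (ProjRep.ofOperators b (regularOp b) (regularOp_injective b)
    (regularOp_mul hb)).integrate_mulVec_eq_zero hφ h0 _ ⊤ (fun _ _ _ => trivial) rfl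
    ((Module.finBasis ℂ (Z → ℂ)).equivFun (Pi.single 1 1)) trivial
  rw [ProjRep.integrate_ofOperators] at hz
  have hz' := (LinearEquiv.map_eq_zero_iff _).1 hz
  ext z
  have h := congrFun hz' z
  rw [Finset.sum_apply, Finset.sum_eq_single z] at h
  · simpa [regularOp] using h
  · intro y _ hy
    have : y⁻¹ * z ≠ 1 := fun h => hy (inv_mul_eq_one.1 h)
    simp [regularOp, Pi.single_apply, this]
  · simp

section CompleteList

variable {ι : Type*} {ρ : ι → ProjRep Z b}

open Classical in
theorem IsCompleteIrrepList.sum_character_mul_star (hρ : IsCompleteIrrepList ρ) (μ ν : ι) :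
    ∑ z : Z, (ρ μ).character z * star ((ρ ν).character z) =
      if μ = ν then (Fintype.card Z : ℂ) else 0 := by
  split_ifs with h
  · rw [← h, ProjRep.sum_character_mul_star_self (hρ.irreducible μ)]
  · exact ProjRep.sum_character_mul_star_of_not_isEquivalent (hρ.irreducible μ)
      (hρ.irreducible ν) fun h' => h (hρ.inequivalent μ ν h')

theorem IsCompleteIrrepList.linearIndependent (hρ : IsCompleteIrrepList ρ) :
    LinearIndependent ℂ fun μ => (ρ μ).character := by
  classical
  rw [linearIndependent_iff']
  intro s c hc ν hν
  have h : ∑ z : Z, (∑ μ ∈ s, c μ • (ρ μ).character) z * star ((ρ ν).character z) = 0 := by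
    simp only [hc, Pi.zero_apply, zero_mul, Finset.sum_const_zero]
  simp only [Finset.sum_apply, Pi.smul_apply, smul_eq_mul, Finset.sum_mul] at h
  rw [Finset.sum_comm] at h
  simp only [mul_assoc, ← Finset.mul_sum, hρ.sum_character_mul_star] at h
  simpa [hν] using h

theorem IsCompleteIrrepList.finite (hρ : IsCompleteIrrepList ρ) : Finite ι :=
  hρ.linearIndependent.finite_of_isNoetherian

theorem IsCompleteIrrepList.span_character (hρ : IsCompleteIrrepList ρ)
    (hb : ∀ x y z, b x y * b (x * y) z = b x (y * z) * b y z) :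
    Submodule.span ℂ (Set.range fun μ => (ρ μ).character) = twistedClassFunctions b := by
  classical
  refine le_antisymm (Submodule.span_le.2 ?_) fun φ hφ => ?_
  · rintro _ ⟨μ, rfl⟩
    exact (ρ μ).character_mem
  have := hρ.finite
  have := Fintype.ofFinite ι
  have hcard : (Fintype.card Z : ℂ) ≠ 0 := Nat.cast_ne_zero.2 Fintype.card_ne_zero
  -- ψ is the orthogonal projection of φ to the span of the characters; the remainder pairs to zero
  -- with every irreducible character.
  set ψ : Z → ℂ := ∑ μ, ((Fintype.card Z : ℂ)⁻¹ * ∑ z, φ z * star ((ρ μ).character z)) •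
    (ρ μ).character with hψ
  have hψmem : ψ ∈ Submodule.span ℂ (Set.range fun μ => (ρ μ).character) :=
    Submodule.sum_mem _ fun μ _ => Submodule.smul_mem _ _ (Submodule.subset_span ⟨μ, rfl⟩)
  have hψF : ψ ∈ twistedClassFunctions b :=
    Submodule.sum_mem _ fun μ _ => Submodule.smul_mem _ _ (ρ μ).character_mem
  have horth : ∀ ν, ∑ z, (φ - ψ) z * star ((ρ ν).character z) = 0 := fun ν => by
    simp only [Pi.sub_apply, sub_mul, Finset.sum_sub_distrib]
    rw [sub_eq_zero]
    symm
    simp only [hψ, Finset.sum_apply, Pi.smul_apply, smul_eq_mul]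
    simp only [Finset.sum_mul (s := (Finset.univ : Finset ι))]
    rw [Finset.sum_comm]
    simp only [mul_assoc _ _ (star ((ρ ν).character _)), ← Finset.mul_sum,
      hρ.sum_character_mul_star]
    simp [mul_comm, hcard]
  have h0 : φ - ψ = 0 := by
    refine eq_zero_of_forall_character hb (Submodule.sub_mem _ hφ hψF) fun σ hσ => ?_
    obtain ⟨ν, hν⟩ := hρ.complete σ hσ
    have := congrArg star (horth ν)
    simp only [star_sum, star_mul', star_star, star_zero] at this
    simpa only [hν.character_eq] using this
  rw [sub_eq_zero.1 h0]
  exact hψmem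

end CompleteList

end Finite

end Completeness

/-! ### Twisted class functions and regular classes -/

section RegularClasses

variable {Z : Type*} [Group Z] {b : Z → Z → Circle}

theorem conjFactor_eq (b : Z → Z → Circle) {h h' x y : Z} (hy : y = x⁻¹)
    (hh : h * y = y * h') : conjFactor b h x = b y h' / b h y := by
  have e : h' = x * h * x⁻¹ := by
    rw [← inv_mul_cancel_left y h', ← hh, hy]; group
  rw [conjFactor, ← e, ← hy]

theorem conjFactor_one (hl : ∀ x, b 1 x = 1) (hr : ∀ x, b x 1 = 1) (h : Z) :
    conjFactor b h 1 = 1 := by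
  simp [conjFactor, hl, hr]

theorem conjFactor_mul (hb : ∀ x y z, b x y * b (x * y) z = b x (y * z) * b y z) (h x y : Z) :
    conjFactor b h (x * y) = conjFactor b (y * h * y⁻¹) x * conjFactor b h y := by
  obtain ⟨u, hu⟩ : ∃ u, u = x⁻¹ := ⟨_, rfl⟩
  obtain ⟨v, hv⟩ : ∃ v, v = y⁻¹ := ⟨_, rfl⟩
  obtain ⟨h₁, hh₁⟩ : ∃ h₁, h₁ = y * h * y⁻¹ := ⟨_, rfl⟩
  obtain ⟨h₂, hh₂⟩ : ∃ h₂, h₁ * u = u * h₂ := ⟨u⁻¹ * h₁ * u, by group⟩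
  have eh : h * v = v * h₁ := by rw [hv, hh₁]; group
  have e₂ : h * (v * u) = v * u * h₂ := by rw [← mul_assoc, eh, mul_assoc, hh₂, mul_assoc]
  have evu : v * u = (x * y)⁻¹ := by rw [hu, hv, mul_inv_rev]
  rw [← hh₁, conjFactor_eq b evu e₂, conjFactor_eq b hu hh₂, conjFactor_eq b hv eh]
  have c₁ := congrArg Additive.ofMul (hb h v u)
  have c₂ := congrArg Additive.ofMul (hb v h₁ u)
  have c₃ := congrArg Additive.ofMul (hb v u h₂)
  rw [eh] at c₁
  rw [hh₂] at c₂
  apply Additive.ofMul.injective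
  simp only [ofMul_mul, ofMul_div] at c₁ c₂ c₃ ⊢
  linear_combination (norm := abel) c₁ - c₂ + c₃

/-- `b`-regular elements of a group. -/
def IsCocycleRegular (b : Z → Z → Circle) (h : Z) : Prop :=
  ∀ k : Z, k * h = h * k → b h k = b k h

theorem conjFactor_eq_of_commute {h x : Z} (hx : x * h = h * x) :
    conjFactor b h x = b x⁻¹ h / b h x⁻¹ := by
  rw [conjFactor, hx, mul_inv_cancel_right]

/-- Two such conjugators differ by some w commuting with h, whose factor is b(w⁻¹,h)/b(h,w⁻¹);
regularity makes it 1. -/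
theorem IsCocycleRegular.conjFactor_congr {h : Z} (hreg : IsCocycleRegular b h)
    (hb : ∀ x y z, b x y * b (x * y) z = b x (y * z) * b y z) {x y : Z}
    (hxy : x * h * x⁻¹ = y * h * y⁻¹) : conjFactor b h x = conjFactor b h y := by
  obtain ⟨w, rfl⟩ : ∃ w, x = y * w := ⟨y⁻¹ * x, by group⟩
  have hw : w * h = h * w := by
    have : y⁻¹ * (y * w * h * (y * w)⁻¹) * y * w = y⁻¹ * (y * h * y⁻¹) * y * w := by rw [hxy]
    simpa [mul_assoc] using this
  have hw' : w⁻¹ * h = h * w⁻¹ := by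
    rw [inv_mul_eq_iff_eq_mul, ← mul_assoc, hw, mul_inv_cancel_right]
  rw [conjFactor_mul hb, hw, mul_inv_cancel_right, conjFactor_eq_of_commute hw, hreg _ hw',
    div_self', mul_one]

/-- Conjugating h by a commuting element that violates regularity gives φ(h) = cφ(h) with c ≠ 1. -/
theorem eq_zero_of_not_isCocycleRegular {φ : Z → ℂ} (hφ : φ ∈ twistedClassFunctions b) {h : Z}
    (hh : ¬ IsCocycleRegular b h) : φ h = 0 := by
  simp only [IsCocycleRegular, not_forall] at hh
  obtain ⟨k, hk, hne⟩ := hh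
  have hk' : k⁻¹ * h = h * k⁻¹ := by
    rw [inv_mul_eq_iff_eq_mul, ← mul_assoc, hk, mul_inv_cancel_right]
  have e := hφ h k⁻¹
  rw [conjFactor_eq_of_commute hk', hk', inv_inv, inv_mul_cancel_right] at e
  by_contra h0
  have e' : ((b k h / b h k : Circle) : ℂ) = 1 :=
    mul_right_cancel₀ h0 (e.symm.trans (one_mul _).symm)
  rw [Circle.coe_eq_one, div_eq_one] at e'
  exact hne e'.symm

theorem apply_eq_zero_of_isConj {φ : Z → ℂ} (hφ : φ ∈ twistedClassFunctions b) {h k : Z}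
    (hk : φ h = 0) (hc : IsConj h k) : φ k = 0 := by
  obtain ⟨x, rfl⟩ := isConj_iff.1 hc
  rw [hφ, hk, mul_zero]

/-- The conjugacy classes that consist of `b`-regular elements. -/
abbrev RegularClass (b : Z → Z → Circle) : Type _ :=
  {c : ConjClasses Z // ∀ h ∈ c.carrier, IsCocycleRegular b h}

/-- Evaluation of a twisted class function at representatives of the regular classes. -/
noncomputable def evalRegular (b : Z → Z → Circle) :
    twistedClassFunctions b →ₗ[ℂ] (RegularClass b → ℂ) where
  toFun φ c := φ.1 (Quotient.out c.1)
  map_add' _ _ := rfl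
  map_smul' _ _ := rfl

theorem ConjClasses.mk_out (c : ConjClasses Z) : ConjClasses.mk (Quotient.out c) = c :=
  Quotient.out_eq c

/-- One nonregular element already forces φ to vanish on its whole class, so it need not be known
that regularity is constant on classes. -/
theorem evalRegular_injective : Function.Injective (evalRegular b) := by
  rw [injective_iff_map_eq_zero]
  rintro ⟨φ, hφ⟩ h0
  ext h
  by_cases hc : ∀ k ∈ (ConjClasses.mk h).carrier, IsCocycleRegular b k
  · exact apply_eq_zero_of_isConj hφ (congrFun h0 ⟨_, hc⟩)
      (ConjClasses.mk_eq_mk_iff_isConj.1 (ConjClasses.mk_out _))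
  · push Not at hc
    obtain ⟨k, hk, hreg⟩ := hc
    exact apply_eq_zero_of_isConj hφ (eq_zero_of_not_isCocycleRegular hφ hreg)
      (ConjClasses.mk_eq_mk_iff_isConj.1 (ConjClasses.mem_carrier_iff_mk_eq.1 hk))

theorem evalRegular_surjective (hb : ∀ x y z, b x y * b (x * y) z = b x (y * z) * b y z)
    (hl : ∀ x, b 1 x = 1) (hr : ∀ x, b x 1 = 1) : Function.Surjective (evalRegular b) := by
  classical
  intro f
  have hex : ∀ h : Z, ∃ x : Z, x * Quotient.out (ConjClasses.mk h) * x⁻¹ = h := fun h =>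
    isConj_iff.1 (ConjClasses.mk_eq_mk_iff_isConj.1 (ConjClasses.mk_out _))
  choose t ht using hex
  set F : ConjClasses Z → ℂ := fun c =>
    if hc : ∀ h ∈ c.carrier, IsCocycleRegular b h then f ⟨c, hc⟩ else 0 with hF
  -- The candidate extension does not depend on the conjugator t: on regular classes by
  -- `conjFactor_congr`, elsewhere because F = 0.
  have key : ∀ h x : Z, x * Quotient.out (ConjClasses.mk h) * x⁻¹ = h →
      (conjFactor b (Quotient.out (ConjClasses.mk h)) (t h) : ℂ) * F (ConjClasses.mk h) =
        conjFactor b (Quotient.out (ConjClasses.mk h)) x * F (ConjClasses.mk h) := by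
    intro h x hx
    by_cases hc : ∀ k ∈ (ConjClasses.mk h).carrier, IsCocycleRegular b k
    · rw [(hc _ (ConjClasses.mem_carrier_iff_mk_eq.2 (ConjClasses.mk_out _))).conjFactor_congr hb
        ((ht h).trans hx.symm)]
    · simp only [hF, dif_neg hc, mul_zero]
  refine ⟨⟨fun h => conjFactor b (Quotient.out (ConjClasses.mk h)) (t h) * F (ConjClasses.mk h),
    fun h x => ?_⟩, ?_⟩
  · have hm : ConjClasses.mk (x * h * x⁻¹) = ConjClasses.mk h :=
      (ConjClasses.mk_eq_mk_iff_isConj.2 (isConj_iff.2 ⟨x, rfl⟩)).symm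
    have hx : x * t h * Quotient.out (ConjClasses.mk (x * h * x⁻¹)) * (x * t h)⁻¹ =
        x * h * x⁻¹ := by
      rw [hm]
      conv_rhs => rw [← ht h]
      group
    change _ = (conjFactor b h x : ℂ) *
      (conjFactor b (Quotient.out (ConjClasses.mk h)) (t h) * F (ConjClasses.mk h))
    refine (key _ _ hx).trans ?_
    rw [hm, conjFactor_mul hb, ht, Circle.coe_mul, mul_assoc]
  · ext ⟨c, hc⟩
    change (conjFactor b (Quotient.out (ConjClasses.mk (Quotient.out c))) _ : ℂ) *
      F (ConjClasses.mk (Quotient.out c)) = _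
    rw [key _ 1 (by rw [ConjClasses.mk_out]; group), conjFactor_one hl hr, ConjClasses.mk_out,
      Circle.coe_one, one_mul]
    exact dif_pos hc

theorem IsCompleteIrrepList.card_eq [Finite Z] {ι : Type*} {ρ : ι → ProjRep Z b}
    (hρ : IsCompleteIrrepList ρ) (hb : ∀ x y z, b x y * b (x * y) z = b x (y * z) * b y z)
    (hl : ∀ x, b 1 x = 1) (hr : ∀ x, b x 1 = 1) : Nat.card ι = Nat.card (RegularClass b) := by
  have := Fintype.ofFinite Z
  have := Fintype.ofFinite (RegularClass b)
  have := hρ.finite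
  have := Fintype.ofFinite ι
  rw [Nat.card_eq_fintype_card, Nat.card_eq_fintype_card,
    ← finrank_span_eq_card hρ.linearIndependent, hρ.span_character hb,
    (LinearEquiv.ofBijective (evalRegular b)
      ⟨evalRegular_injective, evalRegular_surjective hb hl hr⟩).finrank_eq,
    Module.finrank_fintype_fun_eq_card]

end RegularClasses

/-! ### Transport of β-representations along conjugation -/

section Transport

variable {G : Type*} [Group G]

/-- The coboundary of η(·,x) is the quotient of β_{xgx⁻¹}, pulled back by conjugation, by β_g.
Multiplication by η therefore changes one factor system into the other. -/
theorem eta_mul_eta_mul_beta (α : NormalizedThreeCocycle G) {g h k : G} (hh : g * h = h * g)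
    (x : G) :
    eta α g h x * eta α g k x * beta α g h k =
      beta α (x * g * x⁻¹) (x * h * x⁻¹) (x * k * x⁻¹) * eta α g (h * k) x := by
  obtain ⟨y, hy⟩ : ∃ y, y = x⁻¹ := ⟨_, rfl⟩
  obtain ⟨g', hg'⟩ : ∃ g', g' = x * g * x⁻¹ := ⟨_, rfl⟩
  obtain ⟨h', hh'⟩ : ∃ h', h' = x * h * x⁻¹ := ⟨_, rfl⟩
  obtain ⟨k', hk'⟩ : ∃ k', k' = x * k * x⁻¹ := ⟨_, rfl⟩
  have eg : g * y = y * g' := by rw [hy, hg']; group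
  have eh : h * y = y * h' := by rw [hy, hh']; group
  have ek : k * y = y * k' := by rw [hy, hk']; group
  have ehk : h * k * y = y * (h' * k') := by rw [mul_assoc, ek, ← mul_assoc, eh, mul_assoc]
  rw [← hg', ← hh', ← hk', eta_eq α hy eh, eta_eq α hy ek, eta_eq α hy ehk]
  have c₁ := congrArg Additive.ofMul (beta_cocycle α k y hh)
  have c₂ := congrArg Additive.ofMul (beta_cocycle α y k' hh)
  have c₃ := congrArg Additive.ofMul (beta_cocycle α h' k' eg)
  rw [ek] at c₁
  rw [eh] at c₂
  apply Additive.ofMul.injective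
  simp only [ofMul_mul, ofMul_div] at c₁ c₂ c₃ ⊢
  linear_combination (norm := abel) c₁ - c₂ + c₃

theorem mul_coe_cent {g : G} (h : Cent g) : g * (h : G) = h * g :=
  (Subgroup.mem_centralizer_singleton_iff.1 h.2).symm

theorem beta_cocycle_cent (α : NormalizedThreeCocycle G) {g : G} (x y z : Cent g) :
    beta α g x y * beta α g (x * y : Cent g) z = beta α g x (y * z : Cent g) * beta α g y z :=
  beta_cocycle α y z (mul_coe_cent x)

theorem conj_mul_conj_comm {g h : G} (hgh : g * h = h * g) (x : G) :
    x * g * x⁻¹ * (x * h * x⁻¹) = x * h * x⁻¹ * (x * g * x⁻¹) := by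
  calc x * g * x⁻¹ * (x * h * x⁻¹) = x * (g * h) * x⁻¹ := by group
    _ = x * (h * g) * x⁻¹ := by rw [hgh]
    _ = _ := by group

/-- Conjugation by `x` as an isomorphism `Z_g ≃ Z_{xgx⁻¹}`. -/
def centEquiv {g g' : G} (x : G) (hx : x * g * x⁻¹ = g') : Cent g ≃* Cent g' where
  toFun h := ⟨x * h * x⁻¹, Subgroup.mem_centralizer_singleton_iff.2 (by
    rw [← hx]; exact (conj_mul_conj_comm (mul_coe_cent h) x).symm)⟩
  invFun h := ⟨x⁻¹ * h * x, Subgroup.mem_centralizer_singleton_iff.2 (by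
    have e := conj_mul_conj_comm (mul_coe_cent h) x⁻¹
    have hg : x⁻¹ * g' * x = g := by rw [← hx]; group
    rw [inv_inv, hg] at e
    exact e.symm)⟩
  left_inv h := Subtype.ext (by simp [mul_assoc])
  right_inv h := Subtype.ext (by simp [mul_assoc])
  map_mul' h k := Subtype.ext (by simp [mul_assoc])

theorem coe_centEquiv {g g' : G} (x : G) (hx : x * g * x⁻¹ = g') (h : Cent g) :
    (centEquiv x hx h : G) = x * h * x⁻¹ := rfl

variable {α : NormalizedThreeCocycle G}

/-- The transport of a `β_g`-representation of `Z_g` along conjugation by `x`. -/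
noncomputable def BetaRep.transport {g g' : G} (x : G) (hx : x * g * x⁻¹ = g')
    (ρ : BetaRep α g) : BetaRep α g' where
  dim := ρ.dim
  toFun k := Circle.toUnits (eta α g ((centEquiv x hx).symm k) x) •
    ρ.toFun ((centEquiv x hx).symm k)
  map_mul k₁ k₂ := by
    obtain ⟨h₁, rfl⟩ := (centEquiv x hx).surjective k₁
    obtain ⟨h₂, rfl⟩ := (centEquiv x hx).surjective k₂
    rw [← map_mul]
    simp only [MulEquiv.symm_apply_apply, coe_centEquiv]
    have e := congrArg (fun c : Circle => (c : ℂ))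
      (eta_mul_eta_mul_beta α (k := h₂) (mul_coe_cent h₁) x)
    simp only [Circle.coe_mul, hx] at e
    change ((eta α g h₁ x : ℂ) • ρ.mat h₁) * ((eta α g h₂ x : ℂ) • ρ.mat h₂) =
      (beta α g' (x * h₁ * x⁻¹) (x * h₂ * x⁻¹) : ℂ) •
        ((eta α g (h₁ * h₂) x : ℂ) • ρ.mat (h₁ * h₂))
    rw [Matrix.smul_mul, Matrix.mul_smul, ρ.mat_mul, smul_smul, smul_smul, smul_smul, e]

theorem BetaRep.transport_mat {g g' : G} (x : G) (hx : x * g * x⁻¹ = g')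
    (ρ : BetaRep α g) (h : Cent g) :
    (ρ.transport x hx).mat (centEquiv x hx h) = (eta α g h x : ℂ) • ρ.mat h := by
  change ((eta α g ((centEquiv x hx).symm (centEquiv x hx h)) x : ℂ) •
    ρ.mat ((centEquiv x hx).symm (centEquiv x hx h)) : Matrix _ _ ℂ) = _
  rw [MulEquiv.symm_apply_apply]

theorem BetaRep.transport_character {g g' : G} (x : G) (hx : x * g * x⁻¹ = g')
    (ρ : BetaRep α g) (h : Cent g) :
    (ρ.transport x hx).character (centEquiv x hx h) = (eta α g h x : ℂ) * ρ.character h := by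
  rw [ProjRep.character, transport_mat]
  exact Matrix.trace_smul _ _

open Matrix

theorem BetaRep.transport_mulVec {g g' : G} (x : G) (hx : x * g * x⁻¹ = g')
    (ρ : BetaRep α g) (h : Cent g) (v : Fin ρ.dim → ℂ) :
    (ρ.transport x hx).mat (centEquiv x hx h) *ᵥ v = (eta α g h x : ℂ) • (ρ.mat h *ᵥ v) := by
  rw [transport_mat]
  exact Matrix.smul_mulVec _ _ _

/-- Equality, not just equivalence: the extended family must return the chosen representation itself
at g^A. -/
theorem BetaRep.transport_eq_self {g x : G} (hx : x * g * x⁻¹ = g) (h1 : x = 1)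
    (ρ : BetaRep α g) : ρ.transport x hx = ρ := by
  subst h1
  obtain ⟨d, f, hf⟩ := ρ
  have e : ∀ k : Cent g, (centEquiv 1 hx).symm k = k := fun k =>
    (MulEquiv.symm_apply_eq _).2 (Subtype.ext (by simp [coe_centEquiv]))
  simp only [transport, e, eta_one, map_one, one_smul]

theorem BetaRep.transport_isIrreducible {g g' : G} (x : G) (hx : x * g * x⁻¹ = g')
    {ρ : BetaRep α g} (hρ : ρ.IsIrreducible) : (ρ.transport x hx).IsIrreducible := by
  refine ⟨hρ.1, fun W hW => hρ.2 W fun h v hv => ?_⟩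
  have := W.smul_mem (eta α g h x : ℂ)⁻¹ (hW (centEquiv x hx h) v hv)
  rw [transport_mulVec] at this
  exact inv_smul_smul₀ (Circle.coe_ne_zero (eta α g h x)) (ρ.mat h *ᵥ v) ▸ this

theorem BetaRep.isEquivalent_of_transport {g g' : G} (x : G) (hx : x * g * x⁻¹ = g')
    {ρ σ : BetaRep α g} (h : (ρ.transport x hx).IsEquivalent (σ.transport x hx)) :
    ρ.IsEquivalent σ := by
  obtain ⟨f, hf⟩ := h
  refine ⟨f, fun z v => ?_⟩
  have e := hf (centEquiv x hx z) v
  rw [transport_mulVec] at e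
  replace e := (f.map_smul _ _).symm.trans (e.trans (transport_mulVec x hx σ z (f v)))
  exact smul_right_injective _ (Circle.coe_ne_zero (eta α g z x)) e

/-- Serves completeness: an irreducible over g' is moved back to g and identified there. The same f
works, since the η phases of x and x⁻¹ multiply to 1. -/
theorem BetaRep.isEquivalent_transport {g g' : G} (x : G) (hx : x * g * x⁻¹ = g')
    (hx' : x⁻¹ * g' * x⁻¹⁻¹ = g) {σ : BetaRep α g'} {ρ : BetaRep α g}
    (h : (σ.transport x⁻¹ hx').IsEquivalent ρ) : σ.IsEquivalent (ρ.transport x hx) := by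
  obtain ⟨f, hf⟩ := h
  refine ⟨f, fun k v => ?_⟩
  obtain ⟨z, rfl⟩ := (centEquiv x hx).surjective k
  have ez : centEquiv x⁻¹ hx' (centEquiv x hx z) = z :=
    Subtype.ext (by simp [coe_centEquiv, mul_assoc])
  have e := hf (centEquiv x⁻¹ hx' (centEquiv x hx z)) v
  rw [transport_mulVec] at e
  replace e := (f.map_smul _ _).symm.trans e
  rw [ez] at e
  refine Eq.trans ?_ (transport_mulVec x hx ρ z (f v)).symm
  rw [← e]
  have hη := eta_mul α (mul_coe_cent z) x⁻¹ x
  rw [inv_mul_cancel, eta_one, hx, mul_comm] at hη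
  have hη' := congrArg (fun c : Circle => (c : ℂ)) hη
  simp only [Circle.coe_mul, Circle.coe_one] at hη'
  rw [smul_smul, coe_centEquiv, ← hη', one_smul]
  rfl

theorem IsCompleteIrrepList.transport {ι : Type*} {g g' : G} (x : G) (hx : x * g * x⁻¹ = g')
    {ρ : ι → BetaRep α g} (hρ : IsCompleteIrrepList ρ) :
    IsCompleteIrrepList fun μ => (ρ μ).transport x hx where
  irreducible μ := BetaRep.transport_isIrreducible x hx (hρ.irreducible μ)
  inequivalent μ ν h := hρ.inequivalent μ ν (BetaRep.isEquivalent_of_transport x hx h)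
  complete σ hσ := by
    have hx' : x⁻¹ * g' * x⁻¹⁻¹ = g := by rw [← hx]; group
    obtain ⟨μ, hμ⟩ := hρ.complete _ (BetaRep.transport_isIrreducible x⁻¹ hx' hσ)
    exact ⟨μ, BetaRep.isEquivalent_transport x hx hx' hμ⟩

theorem exists_conjugator (rep : ConjClasses G → G)
    (hrep : ∀ A : ConjClasses G, rep A ∈ A.carrier) :
    ∃ t : G → G, (∀ A : ConjClasses G, ∀ g ∈ A.carrier, t g * rep A * (t g)⁻¹ = g) ∧
      ∀ A : ConjClasses G, t (rep A) = 1 := by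
  classical
  have hex : ∀ g : G, ∃ x : G, x * rep (ConjClasses.mk g) * x⁻¹ = g := fun g =>
    isConj_iff.1 (ConjClasses.mk_eq_mk_iff_isConj.1 (ConjClasses.mem_carrier_iff_mk_eq.1 (hrep _)))
  choose t ht using hex
  -- The conjugator is reset to 1 at the representatives, so that transport leaves the given list
  -- unchanged there.
  refine ⟨fun g => if g = rep (ConjClasses.mk g) then 1 else t g, fun A g hg => ?_, fun A => ?_⟩
  · rw [ConjClasses.mem_carrier_iff_mk_eq] at hg
    subst hg
    dsimp only
    split_ifs with h
    · rw [← h]; group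
    · exact ht g
  · dsimp only
    rw [ConjClasses.mem_carrier_iff_mk_eq.1 (hrep A), if_pos rfl]

/-- The conjugators t(xgx⁻¹) and x·t(g) carry g^A to the same element, so they differ by some z in
Z_{g^A}. Conjugation by z multiplies the character by η, and `eta_mul` matches the phases along the
two routes. -/
theorem isTransported_transport {rep : ConjClasses G → G} {I : ConjClasses G → Type*}
    (ρ₀ : (A : ConjClasses G) → I A → BetaRep α (rep A)) {t : G → G}
    (ht : ∀ A : ConjClasses G, ∀ g ∈ A.carrier, t g * rep A * (t g)⁻¹ = g) :
    IsTransported (fun A μ g hg => (ρ₀ A μ).transport (t g) (ht A g hg)) := by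
  intro A μ g hg h x
  obtain ⟨h₀, rfl⟩ := (centEquiv (t g) (ht A g hg)).surjective h
  have hs := ht A _ (conj_mem_carrier hg x)
  have hg' := ht A g hg
  set s := t (x * g * x⁻¹)
  obtain ⟨z, hz⟩ : ∃ z, z = s⁻¹ * x * t g := ⟨_, rfl⟩
  have hsz : s * z = x * t g := by rw [hz]; group
  have hzr : z * rep A * z⁻¹ = rep A := by
    calc z * rep A * z⁻¹ = s⁻¹ * (x * (t g * rep A * (t g)⁻¹) * x⁻¹) * s := by rw [hz]; group
      _ = s⁻¹ * (s * rep A * s⁻¹) * s := by rw [hg', hs]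
      _ = rep A := by group
  have hzc : z * rep A = rep A * z := mul_inv_eq_iff_eq_mul.1 hzr
  let w : Cent (rep A) := ⟨z, Subgroup.mem_centralizer_singleton_iff.2 hzc⟩
  have ew : conjCent x (centEquiv (t g) hg' h₀) = centEquiv s hs (w * h₀ * w⁻¹) := by
    apply Subtype.ext
    change x * (t g * h₀ * (t g)⁻¹) * x⁻¹ = s * (z * h₀ * z⁻¹) * s⁻¹
    calc x * (t g * h₀ * (t g)⁻¹) * x⁻¹ = (x * t g) * h₀ * (x * t g)⁻¹ := by group
      _ = (s * z) * h₀ * (s * z)⁻¹ := by rw [hsz]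
      _ = _ := by group
  have e₁ := eta_mul α (mul_coe_cent h₀) s z
  have e₂ := eta_mul α (mul_coe_cent h₀) x (t g)
  rw [hsz, e₂, hzr, hg'] at e₁
  have e := congrArg (fun c : Circle => (c : ℂ)) e₁
  simp only [Circle.coe_mul] at e
  rw [ew, BetaRep.transport_character, BetaRep.transport_character, ProjRep.character_conj,
    ← mul_assoc, ← mul_assoc]
  exact congrArg (· * (ρ₀ A μ).character h₀) e.symm

end Transport

/-! ### Flat edge assignments -/

section Configurations

variable {G : Type*} [Group G]

/-- Simultaneous conjugation of the edge labels. -/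
def conjConfig (x : G) (c : Config G) : Config G :=
  (x * c.1 * x⁻¹, x * c.2.1 * x⁻¹, x * c.2.2 * x⁻¹)

theorem conjConfig_mul (x y : G) (c : Config G) :
    conjConfig (x * y) c = conjConfig x (conjConfig y c) := by
  simp [conjConfig, mul_assoc]

theorem conjConfig_inv_conjConfig (x : G) (c : Config G) :
    conjConfig x⁻¹ (conjConfig x c) = c := by
  simp [conjConfig, mul_assoc]

theorem conjConfig_conjConfig_inv (x : G) (c : Config G) :
    conjConfig x (conjConfig x⁻¹ c) = c := by
  simp [conjConfig, mul_assoc]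

/-- The assignments that satisfy both face constraints. -/
def IsFlat (c : Config G) : Prop := c.1 * c.2.1 = c.2.1 * c.1 ∧ c.2.2 = c.1 * c.2.1

theorem isFlat_iff (c : Config G) :
    (c.2.1 * c.1 * c.2.2⁻¹ = 1 ∧ c.1 * c.2.1 * c.2.2⁻¹ = 1) ↔ IsFlat c := by
  rw [mul_inv_eq_one, mul_inv_eq_one, IsFlat]
  constructor
  · rintro ⟨h₁, h₂⟩; exact ⟨h₂.trans h₁.symm, h₂.symm⟩
  · rintro ⟨h₁, h₂⟩; exact ⟨(h₂.trans h₁).symm, h₂.symm⟩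

theorem IsFlat.conjConfig {c : Config G} (hc : IsFlat c) (x : G) : IsFlat (conjConfig x c) := by
  refine ⟨conj_mul_conj_comm hc.1 x, ?_⟩
  simp [TQD.conjConfig, hc.2, mul_assoc]

end Configurations

/-! ### The ground space as equivariant functions -/

section TorusGroundSpace

variable {G : Type*} [Fintype G]

theorem opOfBasis_apply (F : Config G → TorusSpace G) (Φ : TorusSpace G) :
    opOfBasis F Φ = ∑ c, Φ c • F c := by
  rw [opOfBasis, Module.Basis.constr_apply_fintype]
  rfl

open Classical in
theorem configKet_apply (c d : Config G) : configKet c d = if d = c then 1 else 0 := by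
  rw [configKet, EuclideanSpace.basisFun_apply, PiLp.single_apply]

open Classical in
theorem opOfBasis_ite_apply (p : Config G → Prop) (Φ : TorusSpace G) (c : Config G) :
    opOfBasis (fun c => if p c then configKet c else 0) Φ c = if p c then Φ c else 0 := by
  rw [opOfBasis_apply, WithLp.ofLp_sum, Finset.sum_apply, Finset.sum_eq_single c]
  · split_ifs <;> simp [configKet_apply]
  · intro d _ hd
    split_ifs <;> simp [configKet_apply, hd.symm]
  · simp

variable [Group G]


theorem vertexOp_apply (α : NormalizedThreeCocycle G) (x : G) (Φ : TorusSpace G) (c : Config G) :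
    vertexOp α x Φ (conjConfig x c) = (vertexPhase α x c.1 c.2.1 : ℂ) * Φ c := by
  rw [vertexOp, opOfBasis_apply, WithLp.ofLp_sum, Finset.sum_apply, Finset.sum_eq_single c]
  · simp [conjConfig, configKet_apply, mul_comm]
  · intro d _ hd
    have hne : conjConfig x c ≠ conjConfig x d := fun h => hd (by
      rw [← conjConfig_inv_conjConfig x d, ← h, conjConfig_inv_conjConfig])
    change Φ d • (vertexPhase α x d.1 d.2.1 : ℂ) • configKet (conjConfig x d) (conjConfig x c) = 0
    rw [configKet_apply, if_neg hne, smul_zero, smul_zero]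
  · simp

theorem vertexOp_apply_of_isFlat (α : NormalizedThreeCocycle G) (x : G) (Φ : TorusSpace G)
    {c : Config G} (hc : IsFlat c) :
    vertexOp α x Φ (conjConfig x c) = (eta α c.1 c.2.1 x : ℂ) * Φ c := by
  rw [vertexOp_apply, vertexPhase_eq_eta α hc.1]

open Classical in
theorem groundProjector_apply (α : NormalizedThreeCocycle G) (Φ : TorusSpace G) (c : Config G) :
    groundProjector α Φ c =
      if IsFlat c then (Fintype.card G : ℂ)⁻¹ * ∑ x : G, vertexOp α x Φ c else 0 := by
  have e : vertexAverage α Φ c = (Fintype.card G : ℂ)⁻¹ * ∑ x : G, vertexOp α x Φ c := by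
    rw [vertexAverage, LinearMap.smul_apply, LinearMap.sum_apply, PiLp.smul_apply, smul_eq_mul,
      WithLp.ofLp_sum, Finset.sum_apply]
  rw [groundProjector, LinearMap.comp_apply, LinearMap.comp_apply, face124, face134,
    opOfBasis_ite_apply (fun c : Config G => c.2.1 * c.1 * c.2.2⁻¹ = 1),
    opOfBasis_ite_apply (fun c : Config G => c.1 * c.2.1 * c.2.2⁻¹ = 1), e]
  simp only [← isFlat_iff, ite_and]

/-- The ground states are the equivariant functions on commuting pairs. -/
theorem mem_groundSpace_iff (α : NormalizedThreeCocycle G) (Φ : TorusSpace G) :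
    Φ ∈ groundSpace α ↔ (∀ c, ¬ IsFlat c → Φ c = 0) ∧
      ∀ c, IsFlat c → ∀ x, Φ (conjConfig x c) = (eta α c.1 c.2.1 x : ℂ) * Φ c := by
  have hcard : (Fintype.card G : ℂ) ≠ 0 := Nat.cast_ne_zero.2 Fintype.card_ne_zero
  rw [groundSpace, LinearMap.mem_eqLocus, LinearMap.id_apply]
  constructor
  · intro h
    have hc : ∀ c, groundProjector α Φ c = Φ c := fun c => by rw [h]
    simp only [groundProjector_apply] at hc
    refine ⟨fun c hf => by rw [← hc, if_neg hf], fun c hf x => ?_⟩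
    rw [← hc (conjConfig x c), ← hc c, if_pos (hf.conjConfig x), if_pos hf, mul_left_comm,
      -- Substituting y = xz in the average lets the cocycle law of η split off the factor for x.
      ← Equiv.sum_comp (Equiv.mulLeft x) fun y => vertexOp α y Φ (conjConfig x c)]
    refine congrArg ((Fintype.card G : ℂ)⁻¹ * ·) ?_
    rw [Finset.mul_sum]
    refine Finset.sum_congr rfl fun z _ => ?_
    obtain ⟨d, hd⟩ : ∃ d, d = conjConfig z⁻¹ c := ⟨_, rfl⟩
    have hdc : c = conjConfig z d := by rw [hd, conjConfig_conjConfig_inv]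
    have hdf : IsFlat d := by rw [hd]; exact hf.conjConfig _
    rw [Equiv.coe_mulLeft, hdc, ← conjConfig_mul, vertexOp_apply_of_isFlat α _ Φ hdf,
      vertexOp_apply_of_isFlat α _ Φ hdf, eta_mul α hdf.1, Circle.coe_mul, mul_assoc]
    rfl
  · rintro ⟨h₀, h₁⟩
    ext c
    rw [groundProjector_apply]
    split_ifs with hf
    · rw [Finset.sum_congr rfl (g := fun _ => Φ c), Finset.sum_const, Finset.card_univ,
        nsmul_eq_mul, inv_mul_cancel_left₀ hcard]
      -- Equivariance makes every A^y Φ take the value Φ(c) at c, so the average does too.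
      intro y _
      have hdf : IsFlat (conjConfig y⁻¹ c) := hf.conjConfig _
      have e₁ := vertexOp_apply_of_isFlat α y Φ hdf
      rw [← h₁ _ hdf, conjConfig_conjConfig_inv] at e₁
      exact e₁
    · exact (h₀ c hf).symm

end TorusGroundSpace

/-! ### The vectors |A,μ⟩ in coordinates -/

section ClassKets

variable {G : Type*} [Group G] {α : NormalizedThreeCocycle G}

open Classical in
/-- The characters of a family of `β_g`-representations over a conjugacy class, extended by zero. -/
noncomputable def classCharacter (A : ConjClasses G) (ρ : (g : G) → g ∈ A.carrier → BetaRep α g)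
    (g h : G) : ℂ :=
  if H : g ∈ A.carrier ∧ h ∈ Cent g then (ρ g H.1).character ⟨h, H.2⟩ else 0

theorem classCharacter_of_mem {A : ConjClasses G} (ρ : (g : G) → g ∈ A.carrier → BetaRep α g)
    {g : G} (hg : g ∈ A.carrier) (h : Cent g) :
    classCharacter A ρ g h = (ρ g hg).character h := dif_pos ⟨hg, h.2⟩

theorem classCharacter_of_not_mem {A : ConjClasses G}
    (ρ : (g : G) → g ∈ A.carrier → BetaRep α g) {g : G} (hg : g ∉ A.carrier) (h : G) :
    classCharacter A ρ g h = 0 := dif_neg fun H => hg H.1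

theorem classCharacter_of_not_commute {A : ConjClasses G}
    (ρ : (g : G) → g ∈ A.carrier → BetaRep α g) {g h : G} (hgh : ¬ g * h = h * g) :
    classCharacter A ρ g h = 0 :=
  dif_neg fun H => hgh (Subgroup.mem_centralizer_singleton_iff.1 H.2).symm

theorem IsTransported.classCharacter_conj {I : ConjClasses G → Type*}
    {ρ : (A : ConjClasses G) → I A → (g : G) → g ∈ A.carrier → BetaRep α g}
    (hρ : IsTransported ρ) (A : ConjClasses G) (μ : I A) (g h x : G) :
    classCharacter A (ρ A μ) (x * g * x⁻¹) (x * h * x⁻¹) =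
      (eta α g h x : ℂ) * classCharacter A (ρ A μ) g h := by
  by_cases hg : g ∈ A.carrier
  · by_cases hgh : g * h = h * g
    · have e := hρ A μ g hg ⟨h, Subgroup.mem_centralizer_singleton_iff.2 hgh.symm⟩ x
      rw [← classCharacter_of_mem, ← classCharacter_of_mem] at e
      exact e
    · rw [classCharacter_of_not_commute _ hgh, classCharacter_of_not_commute, mul_zero]
      intro h'
      have := conj_mul_conj_comm h' x⁻¹
      simp [mul_assoc] at this
      exact hgh this
  · rw [classCharacter_of_not_mem _ hg, classCharacter_of_not_mem, mul_zero]
    intro h'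
    have := conj_mem_carrier h' x⁻¹
    simp [mul_assoc] at this
    exact hg this

variable [Fintype G]

open Classical in
-- Extension by zero replaces sums over dependent subtypes by sums over G, which can be reindexed by
-- conjugation.
theorem sum_classCharacter_smul {E : Type*} [AddCommGroup E] [Module ℂ E] (A : ConjClasses G)
    (ρ : (g : G) → g ∈ A.carrier → BetaRep α g) (f : G → G → E) :
    ∑ g : A.carrier, ∑ h : Cent (g : G), (ρ g g.2).character h • f g h =
      ∑ g : G, ∑ h : G, classCharacter A ρ g h • f g h := by
  refine Fintype.sum_of_injective _ Subtype.val_injective _ _ (fun g hg => ?_) fun g => ?_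
  · refine Finset.sum_eq_zero fun h _ => ?_
    rw [classCharacter_of_not_mem _ fun hg' => hg ⟨⟨g, hg'⟩, rfl⟩, zero_smul]
  · refine Fintype.sum_of_injective _ Subtype.val_injective _ _ (fun h hh => ?_) fun h => ?_
    · rw [classCharacter_of_not_commute _ fun hgh =>
        hh ⟨⟨h, Subgroup.mem_centralizer_singleton_iff.2 hgh.symm⟩, rfl⟩, zero_smul]
    · rw [classCharacter_of_mem ρ g.2]

open Classical in
theorem classKet_apply (A : ConjClasses G) (ρ : (g : G) → g ∈ A.carrier → BetaRep α g)
    (c : Config G) :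
    classKet A ρ c = if c.2.2 = c.1 * c.2.1 then
      ((Real.sqrt (Fintype.card G))⁻¹ : ℂ) * classCharacter A ρ c.1 c.2.1 else 0 := by
  rw [classKet, sum_classCharacter_smul A ρ fun g h => ket g h]
  obtain ⟨a, b, d⟩ := c
  simp only [PiLp.smul_apply, WithLp.ofLp_sum, Finset.sum_apply, ket, configKet_apply,
    Prod.mk.injEq, smul_eq_mul]
  rw [Finset.sum_eq_single a, Finset.sum_eq_single b]
  · by_cases h : d = a * b <;> simp [h]
  · intro h _ hh; simp [hh.symm]
  · simp
  · intro g _ hg; simp [hg.symm]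
  · simp

end ClassKets

/-! ### Orthonormality and spanning -/

section Basis

variable {G : Type*} [Group G] [Fintype G] {α : NormalizedThreeCocycle G}

theorem inner_classKet (A B : ConjClasses G) (ρ : (g : G) → g ∈ A.carrier → BetaRep α g)
    (σ : (g : G) → g ∈ B.carrier → BetaRep α g) :
    inner ℂ (classKet A ρ) (classKet B σ) = (Fintype.card G : ℂ)⁻¹ *
      ∑ g : G, ∑ h : G, classCharacter B σ g h * star (classCharacter A ρ g h) := by
  have hs : ((Real.sqrt (Fintype.card G))⁻¹ : ℂ) * star ((Real.sqrt (Fintype.card G))⁻¹ : ℂ) =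
      (Fintype.card G : ℂ)⁻¹ := by
    rw [star_inv₀, Complex.star_def, Complex.conj_ofReal, ← mul_inv, ← Complex.ofReal_mul,
      Real.mul_self_sqrt (Nat.cast_nonneg _), Complex.ofReal_natCast]
  rw [PiLp.inner_apply, Fintype.sum_prod_type, Finset.mul_sum]
  refine Finset.sum_congr rfl fun g _ => ?_
  rw [Fintype.sum_prod_type, Finset.mul_sum]
  refine Finset.sum_congr rfl fun h _ => ?_
  rw [Finset.sum_eq_single (g * h)]
  · rw [classKet_apply, classKet_apply, if_pos rfl, if_pos rfl, RCLike.inner_apply, ← hs, map_mul]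
    simp only [Complex.star_def]
    ring
  · intro d _ hd
    rw [classKet_apply, if_neg hd, inner_zero_left]
  · simp

/-- Orbit–stabilizer for conjugation: |Z_r| |C^A| = |G|. -/
theorem sum_of_conj_invariant (A : ConjClasses G) {r : G} (hr : r ∈ A.carrier) (F : G → ℂ)
    (h₀ : ∀ g, g ∉ A.carrier → F g = 0) (hF : ∀ g x, F (x * g * x⁻¹) = F g) :
    (Nat.card (Cent r) : ℂ) * ∑ g, F g = Nat.card G * F r := by
  classical
  have h₁ : ∑ g, F g = Nat.card A.carrier * F r := by
    rw [← Fintype.sum_of_injective (Subtype.val : A.carrier → G) Subtype.val_injective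
      (fun _ => F r) F (fun g hg => h₀ g fun hg' => hg ⟨⟨g, hg'⟩, rfl⟩) (fun g => ?_),
      Finset.sum_const, Finset.card_univ, nsmul_eq_mul, Nat.card_eq_fintype_card]
    obtain ⟨x, hx⟩ := isConj_iff.1 (ConjClasses.mk_eq_mk_iff_isConj.1
      ((ConjClasses.mem_carrier_iff_mk_eq.1 hr).trans
        (ConjClasses.mem_carrier_iff_mk_eq.1 g.2).symm))
    rw [← hx, hF]
  have h₂ : Nat.card (Cent r) * Nat.card A.carrier = Nat.card G := by
    have h := MulAction.card_orbit_mul_card_stabilizer_eq_card_group (ConjAct G) r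
    rw [← Nat.card_eq_fintype_card, ← Nat.card_eq_fintype_card,
      ConjAct.orbit_eq_carrier_conjClasses, ConjClasses.mem_carrier_iff_mk_eq.1 hr,
      ← Subgroup.nat_card_centralizer_nat_card_stabilizer, ConjAct.card,
      ← Nat.card_eq_fintype_card] at h
    rw [mul_comm, h]
  rw [h₁, ← mul_assoc, ← Nat.cast_mul, h₂]

variable {I : ConjClasses G → Type*}
  {ρ : (A : ConjClasses G) → I A → (g : G) → g ∈ A.carrier → BetaRep α g}

open Classical in
-- The phases η cancel in χ·star χ, so the sum over h is a class function of g. Orthogonality at r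
-- gives |Z_r|, which the class sum turns into |G|.
theorem IsTransported.sum_classCharacter_mul_star (hρ : IsTransported ρ) (A : ConjClasses G)
    {r : G} (hr : r ∈ A.carrier) (hlist : IsCompleteIrrepList fun μ => ρ A μ r hr) (μ ν : I A) :
    ∑ g : G, ∑ h : G, classCharacter A (ρ A ν) g h * star (classCharacter A (ρ A μ) g h) =
      if ν = μ then (Fintype.card G : ℂ) else 0 := by
  set F : G → ℂ := fun g =>
    ∑ h : G, classCharacter A (ρ A ν) g h * star (classCharacter A (ρ A μ) g h) with hF
  have hconj : ∀ g x, F (x * g * x⁻¹) = F g := by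
    intro g x
    simp only [hF]
    rw [← Equiv.sum_comp (MulAut.conj x).toEquiv]
    refine Finset.sum_congr rfl fun h _ => ?_
    have e : (MulAut.conj x).toEquiv h = x * h * x⁻¹ := rfl
    have e' : (eta α g h x : ℂ) * star (eta α g h x : ℂ) = 1 := by
      rw [Complex.star_def, ← Circle.coe_inv_eq_conj, ← Circle.coe_mul, mul_inv_cancel,
        Circle.coe_one]
    rw [e, hρ.classCharacter_conj, hρ.classCharacter_conj, star_mul', mul_mul_mul_comm, e', one_mul]
  have hr' : F r = if ν = μ then (Nat.card (Cent r) : ℂ) else 0 := by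
    rw [Nat.card_eq_fintype_card, ← hlist.sum_character_mul_star ν μ]
    refine (Fintype.sum_of_injective _ Subtype.val_injective _ _ (fun h hh => ?_) fun h => ?_).symm
    · rw [classCharacter_of_not_commute _ fun hgh =>
        hh ⟨⟨h, Subgroup.mem_centralizer_singleton_iff.2 hgh.symm⟩, rfl⟩, zero_mul]
    · rw [classCharacter_of_mem _ hr, classCharacter_of_mem _ hr]
  have hcard : (Nat.card (Cent r) : ℂ) ≠ 0 := Nat.cast_ne_zero.2 Nat.card_pos.ne'
  have key := sum_of_conj_invariant A hr F (fun g hg => by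
    simp only [hF]
    exact Finset.sum_eq_zero fun h _ => by rw [classCharacter_of_not_mem _ hg, zero_mul]) hconj
  apply mul_left_cancel₀ hcard
  rw [key, hr', ← Nat.card_eq_fintype_card]
  split_ifs
  · rw [mul_comm]
  · simp

theorem IsTransported.orthonormal_classKet (hρ : IsTransported ρ)
    {rep : ConjClasses G → G} (hrep : ∀ A : ConjClasses G, rep A ∈ A.carrier)
    (hlist : ∀ A, IsCompleteIrrepList fun μ => ρ A μ (rep A) (hrep A)) :
    Orthonormal ℂ fun p : (A : ConjClasses G) × I A => classKet p.1 (ρ p.1 p.2) := by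
  classical
  rw [orthonormal_iff_ite]
  rintro ⟨A, μ⟩ ⟨B, ν⟩
  rw [inner_classKet]
  by_cases hAB : A = B
  · subst hAB
    rw [hρ.sum_classCharacter_mul_star A (hrep A) (hlist A)]
    have hcard : (Fintype.card G : ℂ) ≠ 0 := Nat.cast_ne_zero.2 Fintype.card_ne_zero
    by_cases hμν : μ = ν
    · subst hμν
      simp [hcard]
    · have : (⟨A, μ⟩ : (A : ConjClasses G) × I A) ≠ ⟨A, ν⟩ := fun h => hμν (by simpa using h)
      rw [if_neg this, if_neg (Ne.symm hμν), mul_zero]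
  · rw [if_neg fun h => hAB (congrArg Sigma.fst h), Finset.sum_eq_zero, mul_zero]
    intro g _
    refine Finset.sum_eq_zero fun h _ => ?_
    by_cases hg : g ∈ A.carrier
    · rw [classCharacter_of_not_mem (A := B), zero_mul]
      intro hg'
      exact hAB ((ConjClasses.mem_carrier_iff_mk_eq.1 hg).symm.trans
        (ConjClasses.mem_carrier_iff_mk_eq.1 hg'))
    · rw [classCharacter_of_not_mem (A := A) _ hg, star_zero, mul_zero]

theorem IsTransported.classKet_mem_groundSpace (hρ : IsTransported ρ) (A : ConjClasses G)
    (μ : I A) : classKet A (ρ A μ) ∈ groundSpace α := by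
  rw [mem_groundSpace_iff]
  constructor
  · rintro c hc
    rw [classKet_apply]
    split_ifs with h
    · rw [classCharacter_of_not_commute _ fun h' => hc ⟨h', h⟩, mul_zero]
    · rfl
  · rintro c hc x
    rw [classKet_apply, classKet_apply, if_pos hc.2, if_pos (hc.conjConfig x).2, mul_left_comm]
    exact congrArg _ (hρ.classCharacter_conj A μ c.1 c.2.1 x)

/-- Every flat assignment is conjugate to one whose first label is a representative, and
equivariance carries the vanishing along. -/
theorem eq_zero_of_mem_groundSpace {Φ : TorusSpace G} (hΦ : Φ ∈ groundSpace α)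
    {rep : ConjClasses G → G} (hrep : ∀ A : ConjClasses G, rep A ∈ A.carrier)
    (h₀ : ∀ (A : ConjClasses G) (h : Cent (rep A)), Φ (rep A, (h : G), rep A * h) = 0) :
    Φ = 0 := by
  obtain ⟨hΦ₀, hΦ₁⟩ := (mem_groundSpace_iff α Φ).1 hΦ
  ext c
  by_cases hc : IsFlat c
  · obtain ⟨x, hx⟩ := isConj_iff.1 (ConjClasses.mk_eq_mk_iff_isConj.1
      (ConjClasses.mem_carrier_iff_mk_eq.1 (hrep (ConjClasses.mk c.1))))
    obtain ⟨d, hd⟩ : ∃ d, d = conjConfig x⁻¹ c := ⟨_, rfl⟩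
    have hcd : c = conjConfig x d := by rw [hd, conjConfig_conjConfig_inv]
    have hdf : IsFlat d := by rw [hd]; exact hc.conjConfig _
    have hd₁ : d.1 = rep (ConjClasses.mk c.1) := by
      rw [hd]
      simp only [conjConfig]
      nth_rewrite 1 [← hx]
      group
    have hz : Φ d = 0 := by
      have hcomm : rep (ConjClasses.mk c.1) * d.2.1 = d.2.1 * rep (ConjClasses.mk c.1) :=
        hd₁ ▸ hdf.1
      have e : Φ (rep (ConjClasses.mk c.1), d.2.1, rep (ConjClasses.mk c.1) * d.2.1) = 0 :=
        h₀ (ConjClasses.mk c.1) ⟨d.2.1, Subgroup.mem_centralizer_singleton_iff.2 hcomm.symm⟩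
      rwa [← hd₁, ← hdf.2] at e
    rw [hcd, hΦ₁ d hdf, hz, mul_zero]
    rfl
  · exact hΦ₀ c hc

theorem IsTransported.span_classKet (hρ : IsTransported ρ)
    {rep : ConjClasses G → G} (hrep : ∀ A : ConjClasses G, rep A ∈ A.carrier)
    (hlist : ∀ A, IsCompleteIrrepList fun μ => ρ A μ (rep A) (hrep A)) :
    Submodule.span ℂ (Set.range fun p : (A : ConjClasses G) × I A => classKet p.1 (ρ p.1 p.2)) =
      groundSpace α := by
  classical
  refine le_antisymm (Submodule.span_le.2 ?_) fun Φ hΦ => ?_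
  · rintro _ ⟨⟨A, μ⟩, rfl⟩
    exact hρ.classKet_mem_groundSpace A μ
  have hfin : ∀ A, Finite (I A) := fun A => (hlist A).finite
  have hfin' : ∀ A, Fintype (I A) := fun A => Fintype.ofFinite _
  have : Fintype (ConjClasses G) := Fintype.ofFinite _
  have hex : ∀ A : ConjClasses G, ∃ a : I A → ℂ,
      ∑ μ, a μ • (ρ A μ (rep A) (hrep A)).character =
        fun h : Cent (rep A) => Φ (rep A, (h : G), rep A * h) := by
    intro A
    rw [← Submodule.mem_span_range_iff_exists_fun, (hlist A).span_character (beta_cocycle_cent α)]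
    -- For x in Z_{g^A} conjugation fixes the label g^A, so equivariance of Φ becomes the twisted
    -- class function law in h.
    intro h x
    have hf : IsFlat (rep A, (h : G), rep A * h) := ⟨mul_coe_cent h, rfl⟩
    have e := ((mem_groundSpace_iff α Φ).1 hΦ).2 _ hf x
    have hx : (x : G) * rep A * (x : G)⁻¹ = rep A := by
      rw [← mul_coe_cent x, mul_inv_cancel_right]
    have hc : conjConfig (x : G) (rep A, (h : G), rep A * h) =
        (rep A, ((x * h * x⁻¹ : Cent (rep A)) : G), rep A * (x * h * x⁻¹ : Cent (rep A))) := by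
      have h₃ : (x : G) * (rep A * h) * (x : G)⁻¹ = rep A * (x * h * (x : G)⁻¹) := by
        rw [← mul_assoc, ← mul_coe_cent x, mul_assoc (rep A), mul_assoc (rep A)]
      simp only [conjConfig, hx, h₃, Subgroup.coe_mul, Subgroup.coe_inv]
    rw [hc] at e
    exact e
  choose a ha using hex
  have hsq : ((Real.sqrt (Fintype.card G) : ℝ) : ℂ) ≠ 0 := by
    rw [Complex.ofReal_ne_zero, Real.sqrt_ne_zero (Nat.cast_nonneg _)]
    exact Nat.cast_ne_zero.2 Fintype.card_ne_zero
  -- The factor √|G| undoes the normalization in `classKet`, so that Ψ agrees with Φ at the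
  -- representatives.
  set Ψ : TorusSpace G := ∑ A, ∑ μ, (a A μ * (Real.sqrt (Fintype.card G) : ℂ)) •
    classKet A (ρ A μ) with hΨ
  have hΨspan : Ψ ∈ Submodule.span ℂ
      (Set.range fun p : (A : ConjClasses G) × I A => classKet p.1 (ρ p.1 p.2)) :=
    Submodule.sum_mem _ fun A _ => Submodule.sum_mem _ fun μ _ =>
      Submodule.smul_mem _ _ (Submodule.subset_span ⟨⟨A, μ⟩, rfl⟩)
  have hΨground : Ψ ∈ groundSpace α :=
    Submodule.sum_mem _ fun A _ => Submodule.sum_mem _ fun μ _ =>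
      Submodule.smul_mem _ _ (hρ.classKet_mem_groundSpace A μ)
  have h0 : Φ - Ψ = 0 := by
    refine eq_zero_of_mem_groundSpace (Submodule.sub_mem _ hΦ hΨground) hrep fun A h => ?_
    rw [PiLp.sub_apply, sub_eq_zero, hΨ, WithLp.ofLp_sum, Finset.sum_apply, Finset.sum_eq_single A]
    · rw [WithLp.ofLp_sum, Finset.sum_apply, ← congrFun (ha A) h, Finset.sum_apply]
      refine Finset.sum_congr rfl fun μ _ => ?_
      rw [Pi.smul_apply, PiLp.smul_apply, classKet_apply, if_pos rfl,
        classCharacter_of_mem _ (hrep A), smul_eq_mul, smul_eq_mul, mul_assoc,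
        mul_inv_cancel_left₀ hsq]
    · intro B _ hB
      rw [WithLp.ofLp_sum, Finset.sum_apply]
      refine Finset.sum_eq_zero fun μ _ => ?_
      rw [PiLp.smul_apply, classKet_apply, if_pos rfl, classCharacter_of_not_mem, mul_zero,
        smul_zero]
      intro h'
      exact hB ((ConjClasses.mem_carrier_iff_mk_eq.1 h').symm.trans
        (ConjClasses.mem_carrier_iff_mk_eq.1 (hrep A)))
    · simp
  rw [sub_eq_zero.1 h0]
  exact hΨspan

end Basis

end TQD

theorem mainTheorem2 {G : Type*} [Group G] [Fintype G] (α : TQD.NormalizedThreeCocycle G)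
    -- representatives `g^A` of the conjugacy classes
    (rep : ConjClasses G → G) (hrep : ∀ A : ConjClasses G, rep A ∈ A.carrier)
    -- the irreducible `β_{g^A}`-representations of `Z_{g^A}`, labelled by `μ : I A`
    (I : ConjClasses G → Type*) (ρ₀ : (A : ConjClasses G) → I A → TQD.BetaRep α (rep A))
    (hρ₀ : ∀ A : ConjClasses G, TQD.IsCompleteIrrepList (ρ₀ A)) :
    -- they can be transported across the conjugacy classes
    (∃ ρ : (A : ConjClasses G) → I A → (g : G) → g ∈ A.carrier → TQD.BetaRep α g,
      (∀ (A : ConjClasses G) (μ : I A), ρ A μ (rep A) (hrep A) = ρ₀ A μ) ∧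
      (∀ (A : ConjClasses G) (g : G) (hg : g ∈ A.carrier),
        TQD.IsCompleteIrrepList (fun μ : I A => ρ A μ g hg)) ∧
      TQD.IsTransported ρ) ∧
    -- the number of labels
    (∀ A : ConjClasses G,
      Finite (I A) ∧ Nat.card (I A) = TQD.numRegularClasses α (rep A)) ∧
    -- for every such transport, the vectors form an orthonormal basis of the ground space
    (∀ ρ : (A : ConjClasses G) → I A → (g : G) → g ∈ A.carrier → TQD.BetaRep α g,
      (∀ (A : ConjClasses G) (μ : I A), ρ A μ (rep A) (hrep A) = ρ₀ A μ) →
      TQD.IsTransported ρ →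
      Orthonormal ℂ (fun p : (A : ConjClasses G) × I A => TQD.classKet p.1 (ρ p.1 p.2)) ∧
      Submodule.span ℂ
          (Set.range (fun p : (A : ConjClasses G) × I A => TQD.classKet p.1 (ρ p.1 p.2))) =
        TQD.groundSpace α) := by
  classical
  refine ⟨?_, fun A => ⟨(hρ₀ A).finite, (hρ₀ A).card_eq (TQD.beta_cocycle_cent α)
    (fun x => TQD.beta_one_left α _ x) (fun x => TQD.beta_one_right α _ x)⟩, ?_⟩
  · obtain ⟨t, ht, ht₁⟩ := TQD.exists_conjugator rep hrep
    exact ⟨fun A μ g hg => (ρ₀ A μ).transport (t g) (ht A g hg),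
      fun A μ => TQD.BetaRep.transport_eq_self _ (ht₁ A) _,
      fun A g hg => (hρ₀ A).transport _ _, TQD.isTransported_transport ρ₀ ht⟩
  · intro ρ hρ htr
    -- Completeness is needed only at the representatives, where ρ is the given list; (*) controls
    -- the rest of each class.
    have hlist : ∀ A, TQD.IsCompleteIrrepList fun μ => ρ A μ (rep A) (hrep A) := fun A => by
      simp only [hρ]
      exact hρ₀ A
    exact ⟨htr.orthonormal_classKet hrep hlist, htr.span_classKet hrep hlist⟩
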